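/- All Banach spaces are complex. For $1\le p\le\infty$ let $\ell_p$ be the space of complex sequences indexed by $\mathbb N$, and let $\widehat\otimes_\varepsilon^m\ell_p=\ell_p\widehat\otimes_\varepsilon\cdots\widehat\otimes_\varepsilon\ell_p$ ($m$ factors) be the completed injective tensor product, that is, the completion of the algebraic tensor product for the norm $\varepsilon(u)=\sup\{|(\varphi_1\otimes\cdots\otimes\varphi_m)(u)| : \varphi_i\in\ell_p^*,\ \|\varphi_i\|\le 1\}$. For $1\le p_0,p_1\le\infty$ the spaces $\widehat\otimes_\varepsilon^m\ell_{p_0}$ and $\widehat\otimes_\varepsilon^m\ell_{p_1}$ form a compatible couple, each being identified with a space of arrays $(a_{\mathbf i})_{\mathbf i\in\mathbb N^m}$ through the coefficients $a_{\mathbf i}(u)=(e_{i_1}^*\otimes\cdots\otimes e_{i_m}^*)(u)$; let $[\,\cdot\,,\,\cdot\,]_\theta$ denote the complex interpolation method. **Theorem.** Let $m\ge 3$ be an integer, let $m^*=m/(m-1)$, and let $1\le p_0<m^*<p_1\le\infty$. Then for every $\theta\in(0,1)$ the Banach spaces $$\Big[\widehat\otimes_\varepsilon^m\ell_{p_0},\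 \widehat\otimes_\varepsilon^m\ell_{p_1}\Big]_\theta\qquad\text{and}\qquad \widehat\otimes_\varepsilon^m\ell_{p_\theta},\qquad \frac1{p_\theta}=\frac{1-\theta}{p_0}+\frac{\theta}{p_1},$$ are not isomorphic: there is no bounded linear bijection with bounded inverse between them. In particular they do not coincide with equivalent norms. -/

import Mathlib

open scoped ENNReal BoundedContinuousFunction

noncomputable section

/-! ### The injective tensor product of Banach spaces -/

section InjectiveTensor

/-- The Banach space of bounded multilinear forms on a family of normed spaces. -/
abbrev MultilinearForms {ι : Type*} (E : ι → Type*)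
    [∀ i, NormedAddCommGroup (E i)] [∀ i, NormedSpace ℂ (E i)] : Type _ :=
  ContinuousMultilinearMap ℂ E ℂ

/-- Freezing all variables but the `j`-th one. -/
def slotMap {ι : Type*} [Fintype ι] [DecidableEq ι] (E : ι → Type*)
    [∀ i, NormedAddCommGroup (E i)] [∀ i, NormedSpace ℂ (E i)] (φ : ∀ i, E i) (j : ι) :
    MultilinearForms E →L[ℂ] StrongDual ℂ (E j) :=
  LinearMap.mkContinuous
    { toFun := fun u => u.toContinuousLinearMap φ j
      map_add' := fun _ _ => rfl
      map_smul' := fun _ _ => rfl } (∏ i ∈ Finset.univ.erase j, ‖φ i‖) fun u => by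
    refine ContinuousLinearMap.opNorm_le_bound _ (by positivity) fun ψ => ?_
    refine (u.le_opNorm (Function.update φ j ψ)).trans (le_of_eq ?_)
    rw [← Finset.mul_prod_erase _ _ (Finset.mem_univ j),
      Finset.prod_congr rfl (g := fun i => ‖φ i‖) fun i hi => by
        rw [Function.update_of_ne (Finset.ne_of_mem_erase hi)]]
    simp
    ring

variable {ι : Type*} [Fintype ι] (X : ι → Type*)
  [∀ i, NormedAddCommGroup (X i)] [∀ i, NormedSpace ℂ (X i)]

/-- The elementary tensor `⨂ᵢ xᵢ`, regarded as the bounded multilinear form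
`(φᵢ)ᵢ ↦ ∏ᵢ φᵢ (xᵢ)` on the product of the dual spaces. -/
def elementaryTensor (x : ∀ i, X i) :
    MultilinearForms fun i => StrongDual ℂ (X i) :=
  (ContinuousMultilinearMap.mkPiAlgebra ℂ ι ℂ).compContinuousLinearMap
    fun i => NormedSpace.inclusionInDoubleDual ℂ (X i) (x i)

/-- The elementary tensors span the algebraic tensor product inside the Banach space of bounded
multilinear forms on the duals, and there the operator norm is the injective norm
`ε(u) = sup {|(φ₁ ⊗ ⋯ ⊗ φₘ)(u)| : ‖φᵢ‖ ≤ 1}`. The completed injective tensor product is the closure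
of that span. -/
def injectiveTensorSubmodule :
    Submodule ℂ (MultilinearForms fun i => StrongDual ℂ (X i)) :=
  (Submodule.span ℂ (Set.range (elementaryTensor X))).topologicalClosure

/-- The completed injective tensor product `⊗̂_ε Xᵢ`, with the injective norm. -/
abbrev InjectiveTensor : Type _ := injectiveTensorSubmodule X

instance : NormedAddCommGroup (InjectiveTensor X) :=
  (injectiveTensorSubmodule X).normedAddCommGroup

instance : NormedSpace ℂ (InjectiveTensor X) := (injectiveTensorSubmodule X).normedSpace

instance : CompleteSpace (InjectiveTensor X) :=
  (Submodule.isClosed_topologicalClosure _).completeSpace_coe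

@[simp] theorem elementaryTensor_apply (x : ∀ i, X i) (φ : ∀ i, StrongDual ℂ (X i)) :
    elementaryTensor X x φ = ∏ i, φ i (x i) := by
  simp [elementaryTensor]

variable {X}

/-- When all slots but the `j`-th are frozen, a tensor acts on the `j`-th slot as evaluation at a
vector of `X j`. -/
theorem InjectiveTensor.exists_slot [DecidableEq ι] [∀ i, CompleteSpace (X i)]
    (u : InjectiveTensor X) (φ : ∀ i, StrongDual ℂ (X i)) (j : ι) :
    ∃ x : X j, ∀ ψ : StrongDual ℂ (X j), u.1 (Function.update φ j ψ) = ψ x := by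
  let J := NormedSpace.inclusionInDoubleDualLi ℂ (E := X j)
  let L := slotMap (fun i => StrongDual ℂ (X i)) φ j
  have hcl : IsClosed (LinearMap.range J.toLinearMap : Set (StrongDual ℂ (StrongDual ℂ (X j)))) := by
    have h : IsComplete (Set.range J) := J.isometry.isUniformInducing.isComplete_range
    exact h.isClosed
  have hle : injectiveTensorSubmodule X ≤ (LinearMap.range J.toLinearMap).comap L.toLinearMap := by
    refine Submodule.topologicalClosure_minimal _ ?_ (hcl.preimage L.continuous)
    rw [Submodule.span_le]
    rintro _ ⟨x, rfl⟩
    refine ⟨(∏ i ∈ Finset.univ.erase j, φ i (x i)) • x j, ?_⟩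
    ext ψ
    change ψ _ = elementaryTensor X x (Function.update φ j ψ)
    rw [elementaryTensor_apply, ← Finset.mul_prod_erase _ _ (Finset.mem_univ j), map_smul,
      smul_eq_mul, mul_comm, Function.update_self]
    congr 1
    exact Finset.prod_congr rfl fun i hi => by
      rw [Function.update_of_ne (Finset.ne_of_mem_erase hi)]
  obtain ⟨x, hx⟩ := hle u.2
  exact ⟨x, fun ψ => (DFunLike.congr_fun hx ψ).symm⟩

end InjectiveTensor

/-! ### The complex interpolation method -/

section Interpolation

open Complex.HadamardThreeLines

/-- A compatible (interpolation) couple of complex Banach spaces: two spaces embedded linearly,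
continuously and injectively in a Hausdorff topological vector space `V`. -/
structure InterpolationCouple (X₀ X₁ V : Type*)
    [NormedAddCommGroup X₀] [NormedSpace ℂ X₀] [CompleteSpace X₀]
    [NormedAddCommGroup X₁] [NormedSpace ℂ X₁] [CompleteSpace X₁]
    [AddCommGroup V] [Module ℂ V] [TopologicalSpace V] [IsTopologicalAddGroup V]
    [ContinuousSMul ℂ V] [T2Space V] where
  /-- The embedding of the first space. -/
  emb₀ : X₀ →L[ℂ] V
  /-- The embedding of the second space. -/
  emb₁ : X₁ →L[ℂ] V
  injective₀ : Function.Injective emb₀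
  injective₁ : Function.Injective emb₁

namespace InterpolationCouple

variable {X₀ X₁ V : Type*}
  [NormedAddCommGroup X₀] [NormedSpace ℂ X₀] [CompleteSpace X₀]
  [NormedAddCommGroup X₁] [NormedSpace ℂ X₁] [CompleteSpace X₁]
  [AddCommGroup V] [Module ℂ V] [TopologicalSpace V] [IsTopologicalAddGroup V]
  [ContinuousSMul ℂ V] [T2Space V]
  (C : InterpolationCouple X₀ X₁ V)

/-- The map `(x₀, x₁) ↦ x₀ + x₁` into the ambient space. -/
def addMap : WithLp 1 (X₀ × X₁) →L[ℂ] V :=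
  C.emb₀.comp (WithLp.fstL 1 ℂ X₀ X₁) + C.emb₁.comp (WithLp.sndL 1 ℂ X₀ X₁)

/-- The pairs `(x₀, x₁)` with `x₀ + x₁ = 0`. -/
def addKer : Submodule ℂ (WithLp 1 (X₀ × X₁)) := LinearMap.ker C.addMap.toLinearMap

instance isClosed_addKer : IsClosed (C.addKer : Set (WithLp 1 (X₀ × X₁))) :=
  C.addMap.isClosed_ker

/-- The sum space `X₀ + X₁`, with the norm `inf {‖x₀‖ + ‖x₁‖ : a = x₀ + x₁}`. -/
abbrev SumSpace : Type _ := WithLp 1 (X₀ × X₁) ⧸ C.addKer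

/-- The inclusion of `X₀` in `X₀ + X₁`. -/
def inl (x : X₀) : C.SumSpace := C.addKer.mkQ (WithLp.toLp 1 (x, 0))

/-- The inclusion of `X₁` in `X₀ + X₁`. -/
def inr (x : X₁) : C.SumSpace := C.addKer.mkQ (WithLp.toLp 1 (0, x))

/-- The underlying vector space of the Calderón space `𝓕(X₀, X₁)`: the functions `f` with values in
`X₀ + X₁` that are bounded and continuous on the closed strip `0 ≤ re z ≤ 1`, analytic on the open
strip, and whose boundary values `t ↦ f (it)` and `t ↦ f (1 + it)` are bounded continuous functions
`g₀`, `g₁` with values in `X₀` and in `X₁`. The boundary functions are recorded with `f`. (The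
values of `f` off the closed strip play no role: the seminorm below does not see them.) -/
def calderonSubmodule : Submodule ℂ ((ℂ → C.SumSpace) × (ℝ →ᵇ X₀) × (ℝ →ᵇ X₁)) where
  carrier := {F | ContinuousOn F.1 (verticalClosedStrip 0 1) ∧
    DifferentiableOn ℂ F.1 (verticalStrip 0 1) ∧
    (∃ K : ℝ, ∀ z ∈ verticalClosedStrip 0 1, ‖F.1 z‖ ≤ K) ∧
    (∀ t : ℝ, F.1 (t * Complex.I) = C.inl (F.2.1 t)) ∧
    (∀ t : ℝ, F.1 (1 + t * Complex.I) = C.inr (F.2.2 t))}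
  zero_mem' := by
    refine ⟨continuousOn_const, differentiableOn_const _, ⟨0, fun z _ => by simp⟩, ?_, ?_⟩
    · intro t; exact (map_zero C.addKer.mkQ).symm
    · intro t; exact (map_zero C.addKer.mkQ).symm
  add_mem' := by
    rintro F G ⟨hF1, hF2, ⟨K, hK⟩, hF4, hF5⟩ ⟨hG1, hG2, ⟨K', hK'⟩, hG4, hG5⟩
    refine ⟨hF1.add hG1, hF2.add hG2, ⟨K + K', fun z hz =>
      (norm_add_le _ _).trans (add_le_add (hK z hz) (hK' z hz))⟩, fun t => ?_, fun t => ?_⟩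
    · change F.1 _ + G.1 _ = _
      rw [hF4, hG4, inl, inl, ← map_add]
      simp [inl, ← WithLp.toLp_add]
    · change F.1 _ + G.1 _ = _
      rw [hF5, hG5, inr, inr, ← map_add]
      simp [inr, ← WithLp.toLp_add]
  smul_mem' := by
    rintro c F ⟨hF1, hF2, ⟨K, hK⟩, hF4, hF5⟩
    refine ⟨hF1.const_smul c, hF2.const_smul c, ⟨‖c‖ * K, fun z hz => ?_⟩,
      fun t => ?_, fun t => ?_⟩
    · change ‖c • F.1 z‖ ≤ _
      rw [norm_smul]
      exact mul_le_mul_of_nonneg_left (hK z hz) (norm_nonneg _)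
    · change c • F.1 _ = _
      rw [hF4, inl, ← map_smul]
      simp [inl, ← WithLp.toLp_smul]
    · change c • F.1 _ = _
      rw [hF5, inr, ← map_smul]
      simp [inr, ← WithLp.toLp_smul]

/-- The Calderón space `𝓕(X₀, X₁)`. -/
def CalderonSpace : Type _ := C.calderonSubmodule

instance : AddCommGroup C.CalderonSpace := inferInstanceAs (AddCommGroup C.calderonSubmodule)

instance : Module ℂ C.CalderonSpace := inferInstanceAs (Module ℂ C.calderonSubmodule)

/-- The function on the strip underlying an element of the Calderón space, as a linear map. -/
def toFunₗ : C.CalderonSpace →ₗ[ℂ] (ℂ → C.SumSpace) :=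
  (LinearMap.fst ℂ _ _).comp C.calderonSubmodule.subtype

/-- The pair of boundary functions `(t ↦ f (it), t ↦ f (1 + it))`. -/
def boundaryₗ : C.CalderonSpace →ₗ[ℂ] (ℝ →ᵇ X₀) × (ℝ →ᵇ X₁) :=
  (LinearMap.snd ℂ _ _).comp C.calderonSubmodule.subtype

/-- `‖f‖ = max (sup_t ‖f (it)‖_{X₀}) (sup_t ‖f (1 + it)‖_{X₁})`. -/
instance : SeminormedAddCommGroup C.CalderonSpace :=
  SeminormedAddCommGroup.induced _ _ C.boundaryₗ

instance : NormedSpace ℂ C.CalderonSpace := NormedSpace.induced ℂ _ _ C.boundaryₗ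

theorem norm_calderonSpace (F : C.CalderonSpace) :
    ‖F‖ = max ‖(C.boundaryₗ F).1‖ ‖(C.boundaryₗ F).2‖ := rfl

/-- Evaluation `f ↦ f θ`. -/
def evalₗ (θ : ℝ) : C.CalderonSpace →ₗ[ℂ] C.SumSpace :=
  (LinearMap.proj (θ : ℂ)).comp C.toFunₗ

/-- The complex interpolation space `[X₀, X₁]_θ`: the space of values `f θ`, `f ∈ 𝓕(X₀, X₁)`, with
the norm `‖a‖ = inf {‖f‖ : f θ = a}`, that is, `𝓕(X₀, X₁)` modulo the kernel of the evaluation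
at `θ`. -/
abbrev Interpolate (θ : ℝ) : Type _ := C.CalderonSpace ⧸ LinearMap.ker (C.evalₗ θ)

theorem norm_inl_le (x : X₀) : ‖C.inl x‖ ≤ ‖x‖ := by
  refine (Submodule.Quotient.norm_mk_le _ _).trans (le_of_eq ?_)
  simp

theorem norm_inr_le (x : X₁) : ‖C.inr x‖ ≤ ‖x‖ := by
  refine (Submodule.Quotient.norm_mk_le _ _).trans (le_of_eq ?_)
  simp

theorem norm_evalₗ_le {θ : ℝ} (hθ : θ ∈ Set.Icc (0 : ℝ) 1) (F : C.CalderonSpace) :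
    ‖C.evalₗ θ F‖ ≤ ‖F‖ := by
  obtain ⟨⟨f, g₀, g₁⟩, hc, hd, ⟨K, hK⟩, h₀, h₁⟩ := F
  change ‖f θ‖ ≤ max ‖g₀‖ ‖g₁‖
  refine PhragmenLindelof.vertical_strip (a := 0) (b := 1) (f := f) ⟨hd, ?_⟩
    ⟨0, by simpa using Real.pi_pos, 0, ?_⟩ ?_ ?_ (by simpa using hθ.1) (by simpa using hθ.2)
  · refine hc.mono (closure_minimal ?_ ?_)
    · exact Set.preimage_mono Set.Ioo_subset_Icc_self
    · exact isClosed_Icc.preimage Complex.continuous_re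
  · refine Asymptotics.IsBigO.of_bound K (Filter.eventually_inf_principal.2
      (Filter.Eventually.of_forall fun z hz => ?_))
    simpa using hK z (Set.preimage_mono Set.Ioo_subset_Icc_self hz)
  · intro z hz
    have : z = (z.im : ℂ) * Complex.I := by apply Complex.ext <;> simp [hz]
    rw [this]
    exact (congrArg _ (h₀ z.im)).le.trans
      ((C.norm_inl_le _).trans ((g₀.norm_coe_le_norm _).trans (le_max_left _ _)))
  · intro z hz
    have : z = 1 + (z.im : ℂ) * Complex.I := by apply Complex.ext <;> simp [hz]
    rw [this]
    exact (congrArg _ (h₁ z.im)).le.trans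
      ((C.norm_inr_le _).trans ((g₁.norm_coe_le_norm _).trans (le_max_right _ _)))

/-- For `0 ≤ θ ≤ 1` the kernel is closed, so that `[X₀, X₁]_θ` is a normed space. -/
theorem isClosed_ker_evalₗ {θ : ℝ} (hθ : θ ∈ Set.Icc (0 : ℝ) 1) :
    IsClosed (LinearMap.ker (C.evalₗ θ) : Set C.CalderonSpace) :=
  ((C.evalₗ θ).mkContinuous 1 fun F => by simpa using C.norm_evalₗ_le hθ F).isClosed_ker

end InterpolationCouple

end Interpolation

/-! ### The couple of injective tensor products of sequence spaces -/

/-- The space `ℓ_p` of complex sequences. -/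
abbrev SeqSpace (p : ℝ≥0∞) : Type := lp (fun _ : ℕ => ℂ) p

/-- The `m`-fold completed injective tensor product `⊗̂_ε^m ℓ_p`. -/
abbrev TensorSeq (m : ℕ) (p : ℝ≥0∞) [Fact (1 ≤ p)] : Type :=
  InjectiveTensor fun _ : Fin m => SeqSpace p

/-- The coordinate functional `x ↦ x k` on `ℓ_p`. -/
def coordFunctional (p : ℝ≥0∞) [Fact (1 ≤ p)] (k : ℕ) : StrongDual ℂ (SeqSpace p) :=
  lp.evalCLM ℂ (fun _ : ℕ => ℂ) p k

/-- The array of coefficients `u(k₁, …, kₘ) = (e*_{k₁} ⊗ ⋯ ⊗ e*_{kₘ})(u)` of a tensor. -/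
def tensorCoeff (m : ℕ) (p : ℝ≥0∞) [Fact (1 ≤ p)] : TensorSeq m p →L[ℂ] ((Fin m → ℕ) → ℂ) :=
  ContinuousLinearMap.pi fun k =>
    (ContinuousMultilinearMap.apply ℂ (fun _ : Fin m => StrongDual ℂ (SeqSpace p)) ℂ
      fun i => coordFunctional p (k i)).comp (injectiveTensorSubmodule _).subtypeL

theorem tensorCoeff_apply (m : ℕ) (p : ℝ≥0∞) [Fact (1 ≤ p)] (u : TensorSeq m p) (k : Fin m → ℕ) :
    tensorCoeff m p u k = u.1 fun i => coordFunctional p (k i) := rfl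

theorem tensorCoeff_injective (m : ℕ) (p : ℝ≥0∞) [Fact (1 ≤ p)] :
    Function.Injective (tensorCoeff m p) := by
  rw [injective_iff_map_eq_zero]
  intro u hu
  have key : ∀ s : Finset (Fin m), ∀ φ : Fin m → StrongDual ℂ (SeqSpace p),
      (∀ i ∉ s, ∃ k, φ i = coordFunctional p k) → u.1 φ = 0 := by
    intro s
    induction s using Finset.induction_on with
    | empty =>
      intro φ hφ
      choose k hk using fun i => hφ i (Finset.notMem_empty i)
      rw [show φ = fun i => coordFunctional p (k i) from funext hk, ← tensorCoeff_apply, hu]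
      rfl
    | insert j s hj ih =>
      intro φ hφ
      obtain ⟨x, hx⟩ := InjectiveTensor.exists_slot u φ j
      have hx0 : x = 0 := by
        ext k
        change coordFunctional p k x = 0
        rw [← hx]
        refine ih _ fun i hi => ?_
        by_cases hij : i = j
        · subst hij; exact ⟨k, by simp⟩
        · obtain ⟨l, hl⟩ := hφ i (by simp [hij, hi])
          exact ⟨l, by rw [Function.update_of_ne hij, hl]⟩
      have := hx (φ j)
      rwa [Function.update_eq_self, hx0, map_zero] at this
  ext φ
  exact key Finset.univ φ fun i hi => absurd (Finset.mem_univ i) hi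

/-- The couple `(⊗̂_ε^m ℓ_{p₀}, ⊗̂_ε^m ℓ_{p₁})`, where a tensor is identified with its array of
coefficients. -/
def tensorCouple (m : ℕ) (p₀ p₁ : ℝ≥0∞) [Fact (1 ≤ p₀)] [Fact (1 ≤ p₁)] :
    InterpolationCouple (TensorSeq m p₀) (TensorSeq m p₁) ((Fin m → ℕ) → ℂ) where
  emb₀ := tensorCoeff m p₀
  emb₁ := tensorCoeff m p₁
  injective₀ := tensorCoeff_injective m p₀
  injective₁ := tensorCoeff_injective m p₁

end

/-! The two spaces are separated by how fast signed sums of a seminormalized sequence can grow.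
Write x₀, x₁, x for the reciprocals of p₀, p₁, p_θ, so that m(1 - x₀) < 1 < m(1 - x₁) and x = (1 -
θ)x₀ + θx₁.

In the tensor power of ℓ_{p_θ}, the diagonal vectors e_l ⊗ ⋯ ⊗ e_l have norm at least 1, while a
signed sum of N of them has norm at most N^ρ with ρ = max(0, 1 - m(1 - x))
(`norm_sum_diagVector_le`). An isomorphism would carry them to a sequence in the interpolation space
with the same behaviour up to constants.

In the interpolation space, let R_1, …, R_N be restrictions to boxes that are disjoint in every slot
of a nonempty set of slots and frozen to one common index in each other slot. Then ∑ ‖R_k w‖ ≤ C N^σ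
‖w‖ with σ = (1 - θ) m(1 - x₀) + θ. At the endpoint p₀ the exponent m(1 - x₀) comes from
near-norming functionals: averaging over characters decouples the slots (`norm_sum_diag_le`), and
Hölder's inequality bounds each slot by N^(1 - x₀). At p₁ the trivial bound N suffices. The two are
interpolated by `sum_norm_onInterp_le`. This rests on the domination of the interpolation norm by
weighted L¹ norms of the boundary functions, since L¹ norms, unlike suprema, commute with the sum
over k; an analytic function dominating the boundary data provides that bound.

A gliding hump connects the two sides (`ArraySpace.false_of_growth`). The sequence need not tend to
zero coordinatewise in each slot separately, so a minimal set s of slots is chosen on which, after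
freezing the others, it still does not vanish. By minimality the mass escapes to infinity in all
slots of s at once, and a subsequence is almost supported on boxes disjoint in every slot of s. The
sum of N of its members then has N restrictions of norm at least a constant, so cN ≤ C N^σ N^ρ for
all N. But σ < 1 and σ + 1 - m(1 - x) = 1 + θ(1 - m(1 - x₁)) < 1, a contradiction. -/

open scoped ENNReal BoundedContinuousFunction

noncomputable section

open MeasureTheory Filter Topology Complex.HadamardThreeLines InterpolationCouple

/-! ### Cauchy integrals dominating a function on the boundary of a half plane -/

section CauchyKernel

variable {α : ℝ → ℝ} {τ : ℝ}

/-- The Cauchy integral of `α` on the line `re z = -τ`. -/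
def cauchyTransform (α : ℝ → ℝ) (τ : ℝ) (z : ℂ) : ℂ :=
  ∫ s : ℝ, (α s : ℂ) * (z + τ - s * Complex.I)⁻¹

theorem re_le_norm_add_sub (z : ℂ) (τ s : ℝ) : z.re + τ ≤ ‖z + τ - s * Complex.I‖ := by
  refine le_trans (le_of_eq ?_) (Complex.re_le_norm _)
  simp

theorem cauchyKernel_ne_zero {z : ℂ} (hz : 0 < z.re + τ) (s : ℝ) :
    z + τ - s * Complex.I ≠ 0 :=
  norm_pos_iff.1 (hz.trans_le (re_le_norm_add_sub z τ s))

theorem continuous_cauchyKernel {z : ℂ} (hz : 0 < z.re + τ) :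
    Continuous fun s : ℝ => (z + τ - s * Complex.I)⁻¹ :=
  Continuous.inv₀ (by fun_prop) (cauchyKernel_ne_zero hz)

theorem norm_cauchyKernel_le {z : ℂ} (hz : 0 < z.re + τ) (s : ℝ) :
    ‖(z + τ - s * Complex.I)⁻¹‖ ≤ (z.re + τ)⁻¹ := by
  rw [norm_inv]
  exact inv_anti₀ hz (re_le_norm_add_sub z τ s)

theorem integrable_cauchyKernel (hα : Integrable α) {z : ℂ} (hz : 0 < z.re + τ) :
    Integrable fun s : ℝ => (α s : ℂ) * (z + τ - s * Complex.I)⁻¹ := by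
  refine (hα.ofReal (𝕜 := ℂ)).mul_bdd (c := (z.re + τ)⁻¹) ?_ ?_
  · exact (continuous_cauchyKernel hz).aestronglyMeasurable
  · exact Eventually.of_forall (norm_cauchyKernel_le hz)

theorem norm_cauchyTransform_le (hα : Integrable α) (h0 : ∀ s, 0 ≤ α s) {z : ℂ}
    (hz : 0 < z.re + τ) : ‖cauchyTransform α τ z‖ ≤ (z.re + τ)⁻¹ * ∫ s, α s := by
  rw [mul_comm, ← integral_mul_const]
  refine norm_integral_le_of_norm_le (hα.mul_const _) (Eventually.of_forall fun s => ?_)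
  rw [norm_mul, Complex.norm_real, Real.norm_of_nonneg (h0 s)]
  exact mul_le_mul_of_nonneg_left (norm_cauchyKernel_le hz s) (h0 s)

theorem differentiableAt_cauchyTransform (hα : Integrable α) {z : ℂ} (hz : 0 < z.re + τ) :
    DifferentiableAt ℂ (cauchyTransform α τ) z := by
  set d : ℝ := (z.re + τ) / 2 with hd
  have hd0 : 0 < d := by positivity
  have hball : ∀ w ∈ Metric.ball z d, d < w.re + τ := by
    intro w hw
    have h1 : |(w - z).re| < d := (Complex.abs_re_le_norm _).trans_lt (by
      simpa [dist_eq_norm] using hw)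
    have := (abs_lt.1 h1).1
    simp only [Complex.sub_re] at this
    linarith
  have hpos : ∀ w ∈ Metric.ball z d, 0 < w.re + τ := fun w hw => hd0.trans (hball w hw)
  refine (hasDerivAt_integral_of_dominated_loc_of_deriv_le (𝕜 := ℂ)
    (F := fun (w : ℂ) (s : ℝ) => (α s : ℂ) * (w + τ - s * Complex.I)⁻¹)
    (F' := fun (w : ℂ) (s : ℝ) => (α s : ℂ) * (-((w + τ - s * Complex.I)⁻¹) ^ 2))
    (bound := fun s => |α s| * (d⁻¹) ^ 2)
    (Metric.ball_mem_nhds z hd0) ?_ (integrable_cauchyKernel hα hz) ?_ ?_ ?_ ?_).2.differentiableAt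
  · filter_upwards [Metric.ball_mem_nhds z hd0] with w hw
    exact (integrable_cauchyKernel hα (hpos w hw)).aestronglyMeasurable
  · exact (hα.ofReal (𝕜 := ℂ)).aestronglyMeasurable.mul
      ((continuous_cauchyKernel hz).pow 2).neg.aestronglyMeasurable
  · refine Eventually.of_forall fun s w hw => ?_
    rw [norm_mul, Complex.norm_real, norm_neg, norm_pow]
    refine mul_le_mul_of_nonneg_left (pow_le_pow_left₀ (norm_nonneg _) ?_ 2) (abs_nonneg _)
    exact (norm_cauchyKernel_le (hpos w hw) s).trans (inv_anti₀ hd0 (hball w hw).le)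
  · exact hα.abs.mul_const _
  · refine Eventually.of_forall fun s w hw => ?_
    have h := cauchyKernel_ne_zero (hpos w hw) s
    have h1 : HasDerivAt (fun w : ℂ => w + τ - s * Complex.I) 1 w :=
      ((hasDerivAt_id w).add_const _).sub_const _
    have h2 := (h1.inv h).const_mul (α s : ℂ)
    have h3 : -((w + τ - s * Complex.I)⁻¹) ^ 2 = -1 / (w + τ - s * Complex.I) ^ 2 := by
      rw [inv_pow, neg_div, one_div]
    rw [h3]
    exact h2

theorem re_cauchyTransform (hα : Integrable α) {z : ℂ} (hz : 0 < z.re + τ) :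
    (cauchyTransform α τ z).re = ∫ s, α s * ((z + τ - s * Complex.I)⁻¹).re := by
  have h := integral_re (𝕜 := ℂ) (integrable_cauchyKernel hα hz)
  rw [cauchyTransform]
  refine Eq.trans h.symm ?_
  refine integral_congr_ae (Eventually.of_forall fun s => ?_)
  simp

theorem cauchyKernel_re_nonneg {z : ℂ} (hz : 0 < z.re + τ) (s : ℝ) :
    0 ≤ ((z + τ - s * Complex.I)⁻¹).re := by
  rw [Complex.inv_re]
  refine div_nonneg ?_ (Complex.normSq_nonneg _)
  simpa using hz.le

theorem re_cauchyTransform_nonneg (hα : Integrable α) (h0 : ∀ s, 0 ≤ α s) {z : ℂ}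
    (hz : 0 < z.re + τ) : 0 ≤ (cauchyTransform α τ z).re := by
  rw [re_cauchyTransform hα hz]
  exact integral_nonneg fun s => mul_nonneg (h0 s) (cauchyKernel_re_nonneg hz s)

/-- The Poisson kernel of the half plane at height `τ` is at least `1 / (2τ)` on a window of
length `2τ`. -/
theorem le_re_cauchyTransform (hα : Integrable α) (h0 : ∀ s, 0 ≤ α s) (hτ : 0 < τ) {ε t : ℝ}
    (hε : ∀ s, |s - t| < τ → α t - ε ≤ α s) :
    α t - ε ≤ (cauchyTransform α τ (t * Complex.I)).re := by
  have hz : 0 < ((t : ℂ) * Complex.I).re + τ := by simpa using hτ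
  rw [re_cauchyTransform hα hz]
  have hint : Integrable fun s => α s * (((t : ℂ) * Complex.I + τ - s * Complex.I)⁻¹).re := by
    refine (integrable_cauchyKernel hα hz).re.congr (Eventually.of_forall fun s => ?_)
    simp
  calc α t - ε = ∫ s in Set.Ioo (t - τ) (t + τ), (α t - ε) * (2 * τ)⁻¹ := by
        rw [setIntegral_const]
        simp only [Real.volume_real_Ioo_of_le (show t - τ ≤ t + τ by linarith), smul_eq_mul]
        field_simp
        ring
    _ ≤ ∫ s in Set.Ioo (t - τ) (t + τ),
          α s * (((t : ℂ) * Complex.I + τ - s * Complex.I)⁻¹).re := by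
        refine setIntegral_mono_on (integrableOn_const (by simp)) hint.integrableOn
          measurableSet_Ioo fun s hs => ?_
        have hst : |s - t| < τ := by rw [abs_lt]; constructor <;> linarith [hs.1, hs.2]
        refine (mul_le_mul_of_nonneg_right (hε s hst) (inv_nonneg.2 (by linarith))).trans
          (mul_le_mul_of_nonneg_left ?_ (h0 s))
        rw [Complex.inv_re]
        have h1 : ((t : ℂ) * Complex.I + τ - s * Complex.I).re = τ := by simp
        have h2 : Complex.normSq ((t : ℂ) * Complex.I + τ - s * Complex.I) =
            τ * τ + (t - s) * (t - s) := by simp [Complex.normSq_apply]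
        rw [h1, h2, inv_eq_one_div, div_le_div_iff₀ (by positivity)
          (add_pos_of_pos_of_nonneg (mul_pos hτ hτ) (mul_self_nonneg _))]
        have h3 : (t - s) * (t - s) ≤ τ * τ := by
          have := sq_lt_sq.2 (show |s - t| < |τ| by rwa [abs_of_pos hτ])
          nlinarith
        nlinarith
    _ ≤ _ := setIntegral_le_integral hint
        (Eventually.of_forall fun s => mul_nonneg (h0 s) (cauchyKernel_re_nonneg hz s))

end CauchyKernel

/-- A continuous function vanishing at infinity is uniformly continuous, so one window width τ
serves all t. This τ becomes the distance by which the Cauchy integral is moved off the boundary. -/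
theorem exists_window {α : ℝ → ℝ} (hc : Continuous α) (hlim : Tendsto α (cocompact ℝ) (𝓝 0))
    {ε : ℝ} (hε : 0 < ε) : ∃ τ > 0, ∀ s t, |s - t| < τ → α t - ε ≤ α s := by
  obtain ⟨τ, hτ, h⟩ := Metric.uniformContinuous_iff.1
    (hc.uniformContinuous_of_tendsto_cocompact hlim) ε hε
  refine ⟨τ, hτ, fun s t hst => ?_⟩
  have := (abs_lt.1 (h (a := s) (b := t) (by rwa [Real.dist_eq]))).1
  linarith

/-- A nonvanishing analytic function on the closed strip that dominates given boundary data and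
whose value at an interior point is controlled by the integrals of the data. -/
theorem exists_dominating {α β : ℝ → ℝ} (hα : Integrable α) (hβ : Integrable β)
    (hα0 : ∀ t, 0 ≤ α t) (hβ0 : ∀ t, 0 ≤ β t) (hαc : Continuous α) (hβc : Continuous β)
    (hαl : Tendsto α (cocompact ℝ) (𝓝 0)) (hβl : Tendsto β (cocompact ℝ) (𝓝 0))
    {θ : ℝ} (hθ : θ ∈ Set.Ioo (0 : ℝ) 1) {ε : ℝ} (hε : 0 < ε) :
    ∃ h : ℂ → ℂ, (∀ z ∈ verticalClosedStrip 0 1, DifferentiableAt ℂ h z) ∧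
      (∀ z ∈ verticalClosedStrip 0 1, ε ≤ ‖h z‖) ∧
      (∀ t : ℝ, α t ≤ ‖h (t * Complex.I)‖) ∧ (∀ t : ℝ, β t ≤ ‖h (1 + t * Complex.I)‖) ∧
      ‖h θ‖ ≤ ε + θ⁻¹ * (∫ t, α t) + (1 - θ)⁻¹ * ∫ t, β t := by
  obtain ⟨τ₀, hτ₀, hw₀⟩ := exists_window hαc hαl hε
  obtain ⟨τ₁, hτ₁, hw₁⟩ := exists_window hβc hβl hε
  have hβ' : Integrable fun t => β (-t) := hβ.comp_neg
  have hpos₀ : ∀ z ∈ verticalClosedStrip 0 1, 0 < z.re + τ₀ := fun z hz => by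
    have := hz.1; linarith
  have hpos₁ : ∀ z ∈ verticalClosedStrip 0 1, 0 < (1 - z).re + τ₁ := fun z hz => by
    have := hz.2; simp only [Complex.sub_re, Complex.one_re]; linarith
  have hre₀ := fun z hz => re_cauchyTransform_nonneg hα hα0 (hpos₀ z hz)
  have hre₁ := fun z hz => re_cauchyTransform_nonneg hβ' (fun s => hβ0 (-s)) (hpos₁ z hz)
  have hI₀ : ∀ t : ℝ, (t : ℂ) * Complex.I ∈ verticalClosedStrip 0 1 := fun t => by
    simp [verticalClosedStrip]
  have hI₁ : ∀ t : ℝ, 1 + (t : ℂ) * Complex.I ∈ verticalClosedStrip 0 1 := fun t => by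
    simp [verticalClosedStrip]
  -- Both Cauchy integrals live on lines outside the closed strip, re z = -τ₀ and re z = 1 + τ₁, so
  -- h is analytic across the boundary. The reflection z ↦ 1 - z sends 1 + it to -it, hence the
  -- argument -t in β. The real parts of the integrals are nonnegative, so the constant ε bounds |h|
  -- below and also makes up for the loss in α t - ε.
  refine ⟨fun z => ε + cauchyTransform α τ₀ z + cauchyTransform (fun t => β (-t)) τ₁ (1 - z),
    fun z hz => ?_, fun z hz => ?_, fun t => ?_, fun t => ?_, ?_⟩
  · refine ((differentiableAt_const _).add
      (differentiableAt_cauchyTransform hα (hpos₀ z hz))).add ?_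
    exact DifferentiableAt.fun_comp' z (differentiableAt_cauchyTransform hβ' (hpos₁ z hz))
      ((differentiableAt_const _).sub differentiableAt_id)
  · refine le_trans ?_ (Complex.re_le_norm _)
    simp only [Complex.add_re, Complex.ofReal_re]
    linarith [hre₀ z hz, hre₁ z hz]
  · refine le_trans ?_ (Complex.re_le_norm _)
    simp only [Complex.add_re, Complex.ofReal_re]
    have := le_re_cauchyTransform hα hα0 hτ₀ (fun s => hw₀ s t)
    linarith [hre₁ _ (hI₀ t)]
  · refine le_trans ?_ (Complex.re_le_norm _)
    simp only [Complex.add_re, Complex.ofReal_re]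
    have := le_re_cauchyTransform (t := -t) hβ' (fun s => hβ0 (-s)) hτ₁
      (fun s hs => hw₁ (-s) (- -t) (by rw [← abs_neg]; convert hs using 2; ring))
    rw [neg_neg, show ((-t : ℝ) : ℂ) * Complex.I = 1 - (1 + t * Complex.I) by push_cast; ring]
      at this
    linarith [hre₀ _ (hI₁ t)]
  · have hθ' : 0 < 1 - θ := by linarith [hθ.2]
    have e₀ : 0 < (θ : ℂ).re + τ₀ := by have := hθ.1; simp only [Complex.ofReal_re]; linarith
    have e₁ : 0 < (1 - θ : ℂ).re + τ₁ := by simpa using by linarith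
    refine (norm_add₃_le).trans (add_le_add (add_le_add ?_ ?_) ?_)
    · rw [Complex.norm_real, Real.norm_of_nonneg hε.le]
    · refine (norm_cauchyTransform_le hα hα0 e₀).trans ?_
      refine mul_le_mul_of_nonneg_right (inv_anti₀ hθ.1 ?_) (integral_nonneg hα0)
      simpa using hτ₀.le
    · refine (norm_cauchyTransform_le hβ' (fun s => hβ0 (-s)) e₁).trans ?_
      rw [integral_neg_eq_self β]
      refine mul_le_mul_of_nonneg_right (inv_anti₀ hθ' ?_) (integral_nonneg hβ0)
      simpa using hτ₁.le

/-! ### Multipliers on the Calderón space and the L¹ bound for the interpolation norm -/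

namespace InterpolationCouple

variable {X₀ X₁ V : Type*}
  [NormedAddCommGroup X₀] [NormedSpace ℂ X₀] [CompleteSpace X₀]
  [NormedAddCommGroup X₁] [NormedSpace ℂ X₁] [CompleteSpace X₁]
  [AddCommGroup V] [Module ℂ V] [TopologicalSpace V] [IsTopologicalAddGroup V]
  [ContinuousSMul ℂ V] [T2Space V]
  (C : InterpolationCouple X₀ X₁ V)

theorem mem_verticalClosedStrip_I (t : ℝ) : (t : ℂ) * Complex.I ∈ verticalClosedStrip 0 1 := by
  simp [verticalClosedStrip]

theorem mem_verticalClosedStrip_one_add_I (t : ℝ) :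
    1 + (t : ℂ) * Complex.I ∈ verticalClosedStrip 0 1 := by
  simp [verticalClosedStrip]

theorem inl_smul (c : ℂ) (x : X₀) : C.inl (c • x) = c • C.inl x := by
  rw [inl, inl, ← map_smul]; simp [← WithLp.toLp_smul]

theorem inr_smul (c : ℂ) (x : X₁) : C.inr (c • x) = c • C.inr x := by
  rw [inr, inr, ← map_smul]; simp [← WithLp.toLp_smul]

variable {C}

/-- The product of an element of the Calderón space with a bounded scalar function that is analytic
on a neighbourhood of the closed strip. -/
def CalderonSpace.mulFun (F : C.CalderonSpace) (φ : ℂ → ℂ)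
    (hφ : ∀ z ∈ verticalClosedStrip 0 1, DifferentiableAt ℂ φ z) (K : ℝ)
    (hK : ∀ z ∈ verticalClosedStrip 0 1, ‖φ z‖ ≤ K) : C.CalderonSpace :=
  ⟨(fun z => φ z • F.1.1 z,
    BoundedContinuousFunction.ofNormedAddCommGroup (fun t : ℝ => φ (t * Complex.I) • F.1.2.1 t)
      (by
        refine Continuous.smul ?_ F.1.2.1.continuous
        refine continuous_iff_continuousAt.2 fun t => ?_
        exact ContinuousAt.comp' (f := fun t : ℝ => (t : ℂ) * Complex.I)
          (hφ _ (mem_verticalClosedStrip_I t)).continuousAt (by fun_prop))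
      (K * ‖F.1.2.1‖) (fun t => by
        rw [norm_smul]
        exact mul_le_mul (hK _ (mem_verticalClosedStrip_I t)) (F.1.2.1.norm_coe_le_norm t)
          (norm_nonneg _) ((norm_nonneg _).trans (hK _ (mem_verticalClosedStrip_I t)))),
    BoundedContinuousFunction.ofNormedAddCommGroup
      (fun t : ℝ => φ (1 + t * Complex.I) • F.1.2.2 t)
      (by
        refine Continuous.smul ?_ F.1.2.2.continuous
        refine continuous_iff_continuousAt.2 fun t => ?_
        exact ContinuousAt.comp' (f := fun t : ℝ => 1 + (t : ℂ) * Complex.I)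
          (hφ _ (mem_verticalClosedStrip_one_add_I t)).continuousAt (by fun_prop))
      (K * ‖F.1.2.2‖) (fun t => by
        rw [norm_smul]
        exact mul_le_mul (hK _ (mem_verticalClosedStrip_one_add_I t))
          (F.1.2.2.norm_coe_le_norm t)
          (norm_nonneg _) ((norm_nonneg _).trans (hK _ (mem_verticalClosedStrip_one_add_I t))))),
    by
      obtain ⟨⟨f, g₀, g₁⟩, hc, hd, ⟨K', hK'⟩, h₀, h₁⟩ := F
      have hsub : verticalStrip 0 1 ⊆ verticalClosedStrip 0 1 :=
        Set.preimage_mono Set.Ioo_subset_Icc_self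
      refine ⟨?_, ?_, ⟨K * K', fun z hz => ?_⟩, fun t => ?_, fun t => ?_⟩
      · exact ContinuousOn.smul (fun z hz => (hφ z hz).continuousAt.continuousWithinAt) hc
      · exact DifferentiableOn.smul
          (fun z hz => (hφ z (hsub hz)).differentiableWithinAt) hd
      · change ‖φ z • f z‖ ≤ _
        rw [norm_smul]
        exact mul_le_mul (hK z hz) (hK' z hz) (norm_nonneg _) ((norm_nonneg _).trans (hK z hz))
      · change φ _ • f _ = C.inl (φ _ • g₀ t)
        rw [C.inl_smul]
        exact congrArg _ (h₀ t)
      · change φ _ • f _ = C.inr (φ _ • g₁ t)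
        rw [C.inr_smul]
        exact congrArg _ (h₁ t)⟩

variable (C)

/-- The class in `[X₀, X₁]_θ` of an element of the Calderón space. -/
def mkθ (θ : ℝ) : C.CalderonSpace →ₗ[ℂ] C.Interpolate θ :=
  (LinearMap.ker (C.evalₗ θ)).mkQ

variable {C}

theorem mkθ_surjective (θ : ℝ) : Function.Surjective (C.mkθ θ) :=
  Submodule.mkQ_surjective _

theorem mkθ_eq_iff {θ : ℝ} {F G : C.CalderonSpace} :
    C.mkθ θ F = C.mkθ θ G ↔ F.1.1 θ = G.1.1 θ := by
  refine (Submodule.Quotient.eq _).trans ?_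
  rw [LinearMap.mem_ker, map_sub, sub_eq_zero]
  rfl

theorem norm_mkθ_le (θ : ℝ) (F : C.CalderonSpace) : ‖C.mkθ θ F‖ ≤ ‖F‖ :=
  Submodule.Quotient.norm_mk_le _ F

theorem exists_mkθ_eq (θ : ℝ) (w : C.Interpolate θ) {ε : ℝ} (hε : 0 < ε) :
    ∃ F : C.CalderonSpace, C.mkθ θ F = w ∧ ‖F‖ < ‖w‖ + ε :=
  Submodule.Quotient.norm_mk_lt w hε

theorem norm_calderonSpace_le {F : C.CalderonSpace} {M : ℝ} (hM : 0 ≤ M)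
    (h₀ : ∀ t, ‖F.1.2.1 t‖ ≤ M) (h₁ : ∀ t, ‖F.1.2.2 t‖ ≤ M) : ‖F‖ ≤ M := by
  rw [norm_calderonSpace]
  exact max_le ((BoundedContinuousFunction.norm_le hM).2 h₀)
    ((BoundedContinuousFunction.norm_le hM).2 h₁)

theorem norm_boundary₀_le (F : C.CalderonSpace) (t : ℝ) : ‖F.1.2.1 t‖ ≤ ‖F‖ :=
  (F.1.2.1.norm_coe_le_norm t).trans (le_max_left _ _)

theorem norm_boundary₁_le (F : C.CalderonSpace) (t : ℝ) : ‖F.1.2.2 t‖ ≤ ‖F‖ :=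
  (F.1.2.2.norm_coe_le_norm t).trans (le_max_right _ _)

theorem integrable_exp_neg_sq : Integrable fun t : ℝ => Real.exp (-t ^ 2) := by
  simpa using integrable_exp_neg_mul_sq (b := 1) one_pos

theorem tendsto_exp_neg_sq : Tendsto (fun t : ℝ => Real.exp (-t ^ 2)) (cocompact ℝ) (𝓝 0) := by
  refine Real.tendsto_exp_atBot.comp ?_
  refine tendsto_neg_atTop_atBot.comp ?_
  have h := (tendsto_pow_atTop (α := ℝ) two_ne_zero).comp (tendsto_norm_cocompact_atTop (E := ℝ))
  refine h.congr fun t => ?_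
  simp

theorem norm_exp_sq {z : ℂ} {a t : ℝ} (hre : z.re = a) (him : z.im = t) :
    ‖Complex.exp (z ^ 2)‖ = Real.exp (a ^ 2) * Real.exp (-t ^ 2) := by
  rw [Complex.norm_exp, ← Real.exp_add]
  congr 1
  simp [pow_two, hre, him]
  ring

theorem weighted_integrable {E : Type*} [NormedAddCommGroup E] (g : ℝ →ᵇ E) :
    Integrable fun t => ‖g t‖ * Real.exp (-t ^ 2) := by
  refine integrable_exp_neg_sq.bdd_mul (c := ‖g‖) ?_ (Eventually.of_forall fun t => ?_)
  · exact g.continuous.norm.aestronglyMeasurable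
  · rw [norm_norm]; exact g.norm_coe_le_norm t

theorem weighted_tendsto {E : Type*} [NormedAddCommGroup E] (g : ℝ →ᵇ E) :
    Tendsto (fun t => ‖g t‖ * Real.exp (-t ^ 2)) (cocompact ℝ) (𝓝 0) := by
  refine squeeze_zero (fun t => by positivity)
    (fun t => mul_le_mul_of_nonneg_right (g.norm_coe_le_norm t) (Real.exp_pos _).le) ?_
  simpa using tendsto_exp_neg_sq.const_mul ‖g‖

/-- The interpolation norm of a value is controlled by weighted `L¹` norms of the boundary
functions. -/
theorem norm_mkθ_le_integral {θ : ℝ} (hθ : θ ∈ Set.Ioo (0 : ℝ) 1) (F : C.CalderonSpace) :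
    ‖C.mkθ θ F‖ ≤ Real.exp 1 * (θ⁻¹ * (∫ t, ‖F.1.2.1 t‖ * Real.exp (-t ^ 2)) +
      (1 - θ)⁻¹ * ∫ t, ‖F.1.2.2 t‖ * Real.exp (-t ^ 2)) := by
  have hθ0 := hθ.1
  have hθ1 : 0 < 1 - θ := by linarith [hθ.2]
  refine le_of_forall_pos_le_add fun ε hε => ?_
  -- The competitor is G(z) = h(θ) e^{(z-θ)²} F(z) / h(z). It agrees with F at θ. On the boundary
  -- |e^{(z-θ)²}| ≤ e · e^{-t²}, so division by h leaves norms at most |h(θ)|, which is controlled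
  -- by the integrals of the data. The Gaussian factor makes the data integrable and vanishing at
  -- infinity, and the factor e is built into it.
  obtain ⟨h, hd, hlow, hb₀, hb₁, hhθ⟩ := exists_dominating
    (α := fun t => Real.exp 1 * (‖F.1.2.1 t‖ * Real.exp (-t ^ 2)))
    (β := fun t => Real.exp 1 * (‖F.1.2.2 t‖ * Real.exp (-t ^ 2)))
    ((weighted_integrable _).const_mul _) ((weighted_integrable _).const_mul _)
    (fun t => by positivity) (fun t => by positivity) (by fun_prop) (by fun_prop)
    (by simpa using (weighted_tendsto F.1.2.1).const_mul (Real.exp 1))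
    (by simpa using (weighted_tendsto F.1.2.2).const_mul (Real.exp 1)) hθ hε
  have hne : ∀ z ∈ verticalClosedStrip 0 1, h z ≠ 0 := fun z hz =>
    norm_pos_iff.1 (hε.trans_le (hlow z hz))
  have hθm : (θ : ℂ) ∈ verticalClosedStrip 0 1 := by
    simp [verticalClosedStrip, hθ0.le, hθ.2.le]
  have hexp : ∀ a t : ℝ, a ^ 2 ≤ 1 →
      Real.exp (a ^ 2) * Real.exp (-t ^ 2) ≤ Real.exp 1 * Real.exp (-t ^ 2) := fun a t ha =>
    mul_le_mul_of_nonneg_right (Real.exp_le_exp.2 ha) (Real.exp_pos _).le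
  have hE : ∀ z ∈ verticalClosedStrip 0 1,
      ‖Complex.exp ((z - θ) ^ 2)‖ ≤ Real.exp 1 * Real.exp (-z.im ^ 2) := fun z hz => by
    rw [norm_exp_sq (a := z.re - θ) (t := z.im) (by simp) (by simp)]
    refine hexp _ _ ?_
    have h1 := hz.1
    have h2 := hz.2
    have := hθ.2
    rw [sq_le_one_iff_abs_le_one, abs_le]
    constructor <;> linarith
  have hφd : ∀ z ∈ verticalClosedStrip 0 1,
      DifferentiableAt ℂ (fun z => h θ * Complex.exp ((z - θ) ^ 2) * (h z)⁻¹) z := fun z hz =>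
    DifferentiableAt.mul (by fun_prop) ((hd z hz).inv (hne z hz))
  have hφK : ∀ z ∈ verticalClosedStrip 0 1,
      ‖h θ * Complex.exp ((z - θ) ^ 2) * (h z)⁻¹‖ ≤ ‖h θ‖ * Real.exp 1 * ε⁻¹ := fun z hz => by
    rw [norm_mul, norm_mul, norm_inv]
    refine mul_le_mul (mul_le_mul_of_nonneg_left ?_ (norm_nonneg _)) (inv_anti₀ hε (hlow z hz))
      (by positivity) (by positivity)
    refine (hE z hz).trans (mul_le_of_le_one_right (Real.exp_pos _).le ?_)
    exact Real.exp_le_one_iff.2 (by nlinarith [sq_nonneg z.im])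
  set G := F.mulFun _ hφd _ hφK with hG
  have hval : C.mkθ θ F = C.mkθ θ G := by
    rw [mkθ_eq_iff]
    change _ = (h θ * Complex.exp ((θ - θ) ^ 2) * (h θ)⁻¹) • F.1.1 θ
    simp [hne _ hθm]
  have hbound : ∀ (z : ℂ) (t : ℝ), z ∈ verticalClosedStrip 0 1 → z.im = t → ∀ r : ℝ, 0 ≤ r →
      Real.exp 1 * (r * Real.exp (-t ^ 2)) ≤ ‖h z‖ →
      ‖h θ * Complex.exp ((z - θ) ^ 2) * (h z)⁻¹‖ * r ≤ ‖h θ‖ := by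
    intro z t hz hzt r hr hle
    have hpos : 0 < ‖h z‖ := hε.trans_le (hlow z hz)
    rw [norm_mul, norm_mul, norm_inv, mul_assoc, mul_assoc]
    refine mul_le_of_le_one_right (norm_nonneg _) ?_
    rw [mul_comm (‖h z‖)⁻¹, ← mul_assoc, mul_inv_le_iff₀ hpos, one_mul]
    refine le_trans ?_ hle
    rw [mul_comm r, ← mul_assoc]
    refine mul_le_mul_of_nonneg_right ?_ hr
    have := hE z hz
    rwa [hzt] at this
  have hGn : ‖G‖ ≤ ‖h θ‖ := by
    refine norm_calderonSpace_le (norm_nonneg _) (fun t => ?_) (fun t => ?_)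
    · change ‖(h θ * Complex.exp ((t * Complex.I - θ) ^ 2) * (h (t * Complex.I))⁻¹) • F.1.2.1 t‖ ≤ _
      rw [norm_smul]
      exact hbound _ t (mem_verticalClosedStrip_I t) (by simp) _ (norm_nonneg _) (hb₀ t)
    · change ‖(h θ * Complex.exp ((1 + t * Complex.I - θ) ^ 2) * (h (1 + t * Complex.I))⁻¹) •
        F.1.2.2 t‖ ≤ _
      rw [norm_smul]
      exact hbound _ t (mem_verticalClosedStrip_one_add_I t) (by simp) _ (norm_nonneg _) (hb₁ t)
  rw [hval]
  refine ((norm_mkθ_le θ G).trans hGn).trans (hhθ.trans (le_of_eq ?_))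
  rw [integral_const_mul, integral_const_mul]
  ring

/-- The interpolation constant of `norm_mkθ_le_rpow`. -/
def interpConst (θ : ℝ) : ℝ := Real.exp 1 * (θ⁻¹ + (1 - θ)⁻¹)

/-- Multiplying F by r^(z-θ) preserves the value at θ and scales the two boundary functions by
r^(-θ) and r^(1-θ) in norm. The free parameter r is what later turns a sum of two endpoint bounds
into a geometric mean. -/
theorem norm_mkθ_le_rpow {θ : ℝ} (hθ : θ ∈ Set.Ioo (0 : ℝ) 1) (F : C.CalderonSpace) {r : ℝ}
    (hr : 0 < r) :
    ‖C.mkθ θ F‖ ≤ interpConst θ * (r ^ (-θ) * (∫ t, ‖F.1.2.1 t‖ * Real.exp (-t ^ 2)) +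
      r ^ (1 - θ) * ∫ t, ‖F.1.2.2 t‖ * Real.exp (-t ^ 2)) := by
  have hθ0 := hθ.1
  have hθ1 : 0 < 1 - θ := by linarith [hθ.2]
  have hr' : (r : ℂ) ≠ 0 := by exact_mod_cast hr.ne'
  have hnorm : ∀ z : ℂ, ‖(r : ℂ) ^ (z - θ)‖ = r ^ (z.re - θ) := fun z => by
    rw [Complex.norm_cpow_eq_rpow_re_of_pos hr]; simp
  have hd : ∀ z ∈ verticalClosedStrip 0 1, DifferentiableAt ℂ (fun z : ℂ => (r : ℂ) ^ (z - θ)) z :=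
    fun z _ => DifferentiableAt.const_cpow (by fun_prop) (Or.inl hr')
  have hK : ∀ z ∈ verticalClosedStrip 0 1,
      ‖(r : ℂ) ^ (z - θ)‖ ≤ max r r⁻¹ := fun z hz => by
    have h1 := hz.1
    have h2 := hz.2
    have := hθ.2
    rw [hnorm]
    rcases le_total 1 r with h | h
    · refine le_max_of_le_left ?_
      simpa using Real.rpow_le_rpow_of_exponent_le h (show z.re - θ ≤ 1 by linarith)
    · refine le_max_of_le_right ?_
      simpa [Real.rpow_neg_one] using
        Real.rpow_le_rpow_of_exponent_ge hr h (show -1 ≤ z.re - θ by linarith)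
  have hval : C.mkθ θ F = C.mkθ θ (F.mulFun _ hd _ hK) := by
    rw [mkθ_eq_iff]
    change _ = ((r : ℂ) ^ ((θ : ℂ) - θ)) • F.1.1 θ
    simp
  have e₀ : ∀ t, ‖(F.mulFun _ hd _ hK).1.2.1 t‖ = r ^ (-θ) * ‖F.1.2.1 t‖ := fun t => by
    change ‖((r : ℂ) ^ ((t : ℂ) * Complex.I - θ)) • F.1.2.1 t‖ = _
    rw [norm_smul, hnorm]; simp
  have e₁ : ∀ t, ‖(F.mulFun _ hd _ hK).1.2.2 t‖ = r ^ (1 - θ) * ‖F.1.2.2 t‖ := fun t => by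
    change ‖((r : ℂ) ^ (1 + (t : ℂ) * Complex.I - θ)) • F.1.2.2 t‖ = _
    rw [norm_smul, hnorm]; simp
  rw [hval]
  refine (norm_mkθ_le_integral hθ _).trans ?_
  simp_rw [e₀, e₁, mul_assoc, integral_const_mul]
  rw [interpConst, mul_assoc]
  refine mul_le_mul_of_nonneg_left ?_ (Real.exp_pos _).le
  have i₀ : 0 ≤ r ^ (-θ) * ∫ t, ‖F.1.2.1 t‖ * Real.exp (-t ^ 2) :=
    mul_nonneg (by positivity) (integral_nonneg fun t => by positivity)
  have i₁ : 0 ≤ r ^ (1 - θ) * ∫ t, ‖F.1.2.2 t‖ * Real.exp (-t ^ 2) :=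
    mul_nonneg (by positivity) (integral_nonneg fun t => by positivity)
  have := mul_nonneg (inv_pos.2 hθ0).le i₁
  have := mul_nonneg (inv_pos.2 hθ1).le i₀
  rw [add_mul, mul_add, mul_add]
  linarith

end InterpolationCouple

/-! ### Operators on a couple and their action on the interpolation space -/

namespace InterpolationCouple

variable {X₀ X₁ V : Type*}
  [NormedAddCommGroup X₀] [NormedSpace ℂ X₀] [CompleteSpace X₀]
  [NormedAddCommGroup X₁] [NormedSpace ℂ X₁] [CompleteSpace X₁]
  [AddCommGroup V] [Module ℂ V] [TopologicalSpace V] [IsTopologicalAddGroup V]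
  [ContinuousSMul ℂ V] [T2Space V]

/-- An endomorphism of a couple: a pair of bounded operators that agree in the ambient space. -/
structure CoupleEnd (C : InterpolationCouple X₀ X₁ V) where
  /-- The operator on the first space. -/
  map₀ : X₀ →L[ℂ] X₀
  /-- The operator on the second space. -/
  map₁ : X₁ →L[ℂ] X₁
  /-- The operator on the ambient space. -/
  ambient : V →ₗ[ℂ] V
  comm₀ : ∀ x, C.emb₀ (map₀ x) = ambient (C.emb₀ x)
  comm₁ : ∀ x, C.emb₁ (map₁ x) = ambient (C.emb₁ x)

/-- The inclusion of the sum space in the ambient space. -/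
def sumToAmbient (C : InterpolationCouple X₀ X₁ V) : C.SumSpace →ₗ[ℂ] V :=
  C.addKer.liftQ C.addMap.toLinearMap le_rfl

theorem sumToAmbient_injective (C : InterpolationCouple X₀ X₁ V) :
    Function.Injective C.sumToAmbient :=
  LinearMap.ker_eq_bot.1 (Submodule.ker_liftQ_eq_bot _ _ _ le_rfl)

/-- The inclusion of the interpolation space in the ambient space. -/
def toAmbient (C : InterpolationCouple X₀ X₁ V) (θ : ℝ) : C.Interpolate θ →ₗ[ℂ] V :=
  (LinearMap.ker (C.evalₗ θ)).liftQ (C.sumToAmbient.comp (C.evalₗ θ)) fun F hF => by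
    rw [LinearMap.mem_ker] at hF ⊢
    rw [LinearMap.comp_apply, hF, map_zero]

variable {C : InterpolationCouple X₀ X₁ V}

/-- Elements of the interpolation space are determined by their images in the ambient space, so
operator identities can be checked there; for tensors this means on arrays. -/
theorem toAmbient_injective (θ : ℝ) : Function.Injective (C.toAmbient θ) := by
  intro v w h
  obtain ⟨F, rfl⟩ := mkθ_surjective θ v
  obtain ⟨G, rfl⟩ := mkθ_surjective θ w
  exact mkθ_eq_iff.2 (C.sumToAmbient_injective h)

namespace CoupleEnd

variable (A : C.CoupleEnd)

/-- The action on pairs. -/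
def onProd : WithLp 1 (X₀ × X₁) →L[ℂ] WithLp 1 (X₀ × X₁) :=
  (WithLp.prodContinuousLinearEquiv 1 ℂ X₀ X₁).symm.toContinuousLinearMap.comp
    ((A.map₀.prodMap A.map₁).comp
      (WithLp.prodContinuousLinearEquiv 1 ℂ X₀ X₁).toContinuousLinearMap)

theorem addMap_onProd (x : WithLp 1 (X₀ × X₁)) :
    C.addMap (A.onProd x) = A.ambient (C.addMap x) := by
  change C.emb₀ (A.map₀ x.fst) + C.emb₁ (A.map₁ x.snd) = A.ambient (C.emb₀ x.fst + C.emb₁ x.snd)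
  rw [A.comm₀, A.comm₁, map_add]

/-- The action on the sum space. -/
def onSum : C.SumSpace →L[ℂ] C.SumSpace where
  toLinearMap := C.addKer.mapQ C.addKer A.onProd.toLinearMap fun x hx => by
    change C.addMap (A.onProd x) = 0
    have hx' : C.addMap x = 0 := hx
    rw [addMap_onProd, hx', map_zero]
  cont := by
    refine (C.addKer.isQuotientMap_mkQL).continuous_iff.2 ?_
    exact C.addKer.mkQL.continuous.comp A.onProd.continuous

theorem onSum_inl (x : X₀) : A.onSum (C.inl x) = C.inl (A.map₀ x) := by
  change C.addKer.mkQ (A.onProd _) = C.addKer.mkQ _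
  congr 1
  change WithLp.toLp 1 (A.map₀ x, A.map₁ 0) = _
  rw [map_zero]

theorem onSum_inr (x : X₁) : A.onSum (C.inr x) = C.inr (A.map₁ x) := by
  change C.addKer.mkQ (A.onProd _) = C.addKer.mkQ _
  congr 1
  change WithLp.toLp 1 (A.map₀ 0, A.map₁ x) = _
  rw [map_zero]

theorem sumToAmbient_onSum (x : C.SumSpace) :
    C.sumToAmbient (A.onSum x) = A.ambient (C.sumToAmbient x) := by
  obtain ⟨x, rfl⟩ := C.addKer.mkQ_surjective x
  exact A.addMap_onProd x

/-- The action on the Calderón space. -/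
def onCalderon : C.CalderonSpace →ₗ[ℂ] C.CalderonSpace where
  toFun F := ⟨(fun z => A.onSum (F.1.1 z), A.map₀.compLeftContinuousBounded ℝ F.1.2.1,
    A.map₁.compLeftContinuousBounded ℝ F.1.2.2), by
      obtain ⟨⟨f, g₀, g₁⟩, hc, hd, ⟨K, hK⟩, h₀, h₁⟩ := F
      refine ⟨A.onSum.continuous.comp_continuousOn hc, A.onSum.differentiable.comp_differentiableOn hd,
        ⟨‖A.onSum‖ * K, fun z hz => ?_⟩, fun t => ?_, fun t => ?_⟩
      · exact (A.onSum.le_opNorm _).trans (mul_le_mul_of_nonneg_left (hK z hz) (norm_nonneg _))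
      · exact (congrArg _ (h₀ t)).trans (A.onSum_inl _)
      · exact (congrArg _ (h₁ t)).trans (A.onSum_inr _)⟩
  map_add' F G := by
    refine Subtype.ext (Prod.ext ?_ (Prod.ext ?_ ?_))
    · funext z; exact map_add A.onSum _ _
    · ext t; exact map_add A.map₀ _ _
    · ext t; exact map_add A.map₁ _ _
  map_smul' c F := by
    refine Subtype.ext (Prod.ext ?_ (Prod.ext ?_ ?_))
    · funext z; exact map_smul A.onSum _ _
    · ext t; exact map_smul A.map₀ _ _
    · ext t; exact map_smul A.map₁ _ _

/-- The action on the interpolation space. -/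
def onInterp (θ : ℝ) : C.Interpolate θ →ₗ[ℂ] C.Interpolate θ :=
  (LinearMap.ker (C.evalₗ θ)).mapQ (LinearMap.ker (C.evalₗ θ)) A.onCalderon fun F hF => by
    have hF' : F.1.1 θ = 0 := hF
    change A.onSum (F.1.1 θ) = 0
    rw [hF', map_zero]

theorem toAmbient_onInterp (θ : ℝ) (w : C.Interpolate θ) :
    C.toAmbient θ (A.onInterp θ w) = A.ambient (C.toAmbient θ w) := by
  obtain ⟨F, rfl⟩ := mkθ_surjective θ w
  exact A.sumToAmbient_onSum _

end CoupleEnd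

/-- The mass `∫ e^{-t²} dt` of the weight. -/
def gaussMass : ℝ := ∫ t : ℝ, Real.exp (-t ^ 2)

theorem gaussMass_nonneg : 0 ≤ gaussMass := integral_nonneg fun _ => (Real.exp_pos _).le

theorem interpConst_nonneg {θ : ℝ} (hθ : θ ∈ Set.Ioo (0 : ℝ) 1) : 0 ≤ interpConst θ := by
  have := hθ.1
  have : 0 < 1 - θ := by linarith [hθ.2]
  rw [interpConst]
  positivity

theorem norm_onInterp_mkθ_le {θ : ℝ} (hθ : θ ∈ Set.Ioo (0 : ℝ) 1) (A : C.CoupleEnd)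
    (F : C.CalderonSpace) {r : ℝ} (hr : 0 < r) :
    ‖A.onInterp θ (C.mkθ θ F)‖ ≤
      interpConst θ * (r ^ (-θ) * (∫ t, ‖A.map₀ (F.1.2.1 t)‖ * Real.exp (-t ^ 2)) +
      r ^ (1 - θ) * ∫ t, ‖A.map₁ (F.1.2.2 t)‖ * Real.exp (-t ^ 2)) :=
  norm_mkθ_le_rpow hθ (A.onCalderon F) hr

/-- Interpolation of lower `ℓ₁`-type estimates for finite families of operators. -/
theorem sum_norm_onInterp_le {θ : ℝ} (hθ : θ ∈ Set.Ioo (0 : ℝ) 1) {K : Type*} [Fintype K]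
    (A : K → C.CoupleEnd) {a₀ a₁ : ℝ} (ha₀ : 0 < a₀) (ha₁ : 0 < a₁)
    (h₀ : ∀ x, ∑ k, ‖(A k).map₀ x‖ ≤ a₀ * ‖x‖) (h₁ : ∀ x, ∑ k, ‖(A k).map₁ x‖ ≤ a₁ * ‖x‖)
    (w : C.Interpolate θ) :
    ∑ k, ‖(A k).onInterp θ w‖ ≤
      interpConst θ * (2 * gaussMass) * (a₀ ^ (1 - θ) * a₁ ^ θ) * ‖w‖ := by
  have hc := interpConst_nonneg hθ
  have hg := gaussMass_nonneg
  have key : ∀ F : C.CalderonSpace, ∑ k, ‖(A k).onInterp θ (C.mkθ θ F)‖ ≤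
      interpConst θ * (2 * gaussMass) * (a₀ ^ (1 - θ) * a₁ ^ θ) * ‖F‖ := by
    intro F
    -- The choice r = a₀ / a₁ balances the two terms: r^(-θ) a₀ and r^(1-θ) a₁ both equal a₀^(1-θ)
    -- a₁^θ. Each boundary contributes one `gaussMass`, whence the factor 2.
    have hr : 0 < a₀ / a₁ := div_pos ha₀ ha₁
    have j₀ : ∀ k, Integrable fun t => ‖(A k).map₀ (F.1.2.1 t)‖ * Real.exp (-t ^ 2) :=
      fun k => weighted_integrable ((A k).onCalderon F).1.2.1
    have i₀ : ∑ k, ∫ t, ‖(A k).map₀ (F.1.2.1 t)‖ * Real.exp (-t ^ 2) ≤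
        a₀ * ‖F‖ * gaussMass := by
      rw [← integral_finsetSum _ fun k _ => j₀ k, gaussMass, ← integral_const_mul]
      refine integral_mono (integrable_finsetSum _ fun k _ => j₀ k) (integrable_exp_neg_sq.const_mul _)
        fun t => ?_
      rw [← Finset.sum_mul]
      exact mul_le_mul_of_nonneg_right ((h₀ _).trans
        (mul_le_mul_of_nonneg_left (norm_boundary₀_le F t) ha₀.le)) (Real.exp_pos _).le
    have j₁ : ∀ k, Integrable fun t => ‖(A k).map₁ (F.1.2.2 t)‖ * Real.exp (-t ^ 2) :=
      fun k => weighted_integrable ((A k).onCalderon F).1.2.2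
    have i₁ : ∑ k, ∫ t, ‖(A k).map₁ (F.1.2.2 t)‖ * Real.exp (-t ^ 2) ≤
        a₁ * ‖F‖ * gaussMass := by
      rw [← integral_finsetSum _ fun k _ => j₁ k, gaussMass, ← integral_const_mul]
      refine integral_mono (integrable_finsetSum _ fun k _ => j₁ k) (integrable_exp_neg_sq.const_mul _)
        fun t => ?_
      rw [← Finset.sum_mul]
      exact mul_le_mul_of_nonneg_right ((h₁ _).trans
        (mul_le_mul_of_nonneg_left (norm_boundary₁_le F t) ha₁.le)) (Real.exp_pos _).le
    have e₀ : (a₀ / a₁) ^ (-θ) * a₀ = a₀ ^ (1 - θ) * a₁ ^ θ := by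
      rw [Real.div_rpow ha₀.le ha₁.le, Real.rpow_neg ha₁.le, div_inv_eq_mul, sub_eq_neg_add,
        Real.rpow_add_one ha₀.ne']
      ring
    have e₁ : (a₀ / a₁) ^ (1 - θ) * a₁ = a₀ ^ (1 - θ) * a₁ ^ θ := by
      rw [Real.div_rpow ha₀.le ha₁.le, Real.rpow_sub ha₁, Real.rpow_one]
      have := (Real.rpow_pos_of_pos ha₁ θ).ne'
      field_simp
    refine (Finset.sum_le_sum fun k _ => norm_onInterp_mkθ_le hθ (A k) F hr).trans ?_
    rw [← Finset.mul_sum, Finset.sum_add_distrib, ← Finset.mul_sum, ← Finset.mul_sum]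
    refine (mul_le_mul_of_nonneg_left (add_le_add
      (mul_le_mul_of_nonneg_left i₀ (by positivity))
      (mul_le_mul_of_nonneg_left i₁ (by positivity))) hc).trans (le_of_eq ?_)
    rw [mul_assoc a₀, mul_assoc a₁, ← mul_assoc _ a₀, ← mul_assoc _ a₁, e₀, e₁]
    ring
  refine le_of_forall_pos_le_add fun ε hε => ?_
  set M := interpConst θ * (2 * gaussMass) * (a₀ ^ (1 - θ) * a₁ ^ θ) with hM
  have hM0 : 0 ≤ M := by positivity
  obtain ⟨F, rfl, hF⟩ := exists_mkθ_eq θ w (ε := ε / (M + 1)) (by positivity)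
  refine (key F).trans ((mul_le_mul_of_nonneg_left hF.le hM0).trans ?_)
  rw [mul_add]
  refine add_le_add le_rfl ?_
  rw [mul_div_assoc', div_le_iff₀ (by positivity)]
  nlinarith

/-- If operators tend strongly to zero on the first space and are bounded on the second one, they
tend strongly to zero on the interpolation space. -/
theorem tendsto_onInterp {θ : ℝ} (hθ : θ ∈ Set.Ioo (0 : ℝ) 1) (A : ℕ → C.CoupleEnd) {K : ℝ}
    (hK₀ : ∀ n x, ‖(A n).map₀ x‖ ≤ K * ‖x‖) (hK₁ : ∀ n x, ‖(A n).map₁ x‖ ≤ K * ‖x‖)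
    (hlim : ∀ x, Tendsto (fun n => (A n).map₀ x) atTop (𝓝 0)) (w : C.Interpolate θ) :
    Tendsto (fun n => ‖(A n).onInterp θ w‖) atTop (𝓝 0) := by
  obtain ⟨F, rfl⟩ := mkθ_surjective θ w
  have hc := interpConst_nonneg hθ
  have hθ1 : 0 < 1 - θ := by linarith [hθ.2]
  set I₀ : ℕ → ℝ := fun n => ∫ t, ‖(A n).map₀ (F.1.2.1 t)‖ * Real.exp (-t ^ 2) with hI₀
  set B : ℝ := |K| * ‖F‖ * gaussMass with hB
  have hlim₀ : Tendsto I₀ atTop (𝓝 0) := by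
    have := tendsto_integral_of_dominated_convergence (μ := volume)
      (F := fun n t => ‖(A n).map₀ (F.1.2.1 t)‖ * Real.exp (-t ^ 2)) (f := fun _ => (0 : ℝ))
      (fun t => |K| * ‖F‖ * Real.exp (-t ^ 2))
      (fun n => (weighted_integrable ((A n).onCalderon F).1.2.1).aestronglyMeasurable)
      (integrable_exp_neg_sq.const_mul _)
      (fun n => Eventually.of_forall fun t => by
        rw [Real.norm_of_nonneg (by positivity)]
        refine mul_le_mul_of_nonneg_right ((hK₀ n _).trans ?_) (Real.exp_pos _).le
        exact mul_le_mul (le_abs_self K) (norm_boundary₀_le F t) (norm_nonneg _) (abs_nonneg _))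
      (Eventually.of_forall fun t => by
        simpa using ((hlim (F.1.2.1 t)).norm).mul_const (Real.exp (-t ^ 2)))
    simpa using this
  have hI₁ : ∀ n, ∫ t, ‖(A n).map₁ (F.1.2.2 t)‖ * Real.exp (-t ^ 2) ≤ B := fun n => by
    rw [hB, gaussMass, ← integral_const_mul]
    refine integral_mono (weighted_integrable ((A n).onCalderon F).1.2.2)
      (integrable_exp_neg_sq.const_mul _) fun t => ?_
    refine mul_le_mul_of_nonneg_right ((hK₁ n _).trans ?_) (Real.exp_pos _).le
    exact mul_le_mul (le_abs_self K) (norm_boundary₁_le F t) (norm_nonneg _) (abs_nonneg _)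
  have hup : ∀ r > 0, ∀ n, ‖(A n).onInterp θ (C.mkθ θ F)‖ ≤
      interpConst θ * (r ^ (-θ) * I₀ n + r ^ (1 - θ) * B) := fun r hr n => by
    refine (norm_onInterp_mkθ_le hθ (A n) F hr).trans (mul_le_mul_of_nonneg_left ?_ hc)
    exact add_le_add le_rfl (mul_le_mul_of_nonneg_left (hI₁ n) (by positivity))
  -- First r is taken small, which makes the merely bounded contribution of the second endpoint
  -- small; for this fixed r the first contribution tends to zero as n grows.
  have hsmall : Tendsto (fun r : ℝ => interpConst θ * (r ^ (1 - θ) * B)) (𝓝[>] 0) (𝓝 0) := by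
    have h : Tendsto (fun r : ℝ => r ^ (1 - θ)) (𝓝 0) (𝓝 0) := by
      have := (Real.continuousAt_rpow_const 0 (1 - θ) (Or.inr hθ1.le)).tendsto
      rwa [Real.zero_rpow hθ1.ne'] at this
    simpa using (((h.mono_left nhdsWithin_le_nhds).mul_const B).const_mul (interpConst θ))
  rw [Metric.tendsto_nhds]
  intro ε hε
  obtain ⟨r, hr, hr0⟩ := ((hsmall.eventually_lt_const (half_pos hε)).and
    self_mem_nhdsWithin).exists
  have h2 : Tendsto (fun n => interpConst θ * (r ^ (-θ) * I₀ n)) atTop (𝓝 0) := by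
    simpa using (hlim₀.const_mul (r ^ (-θ))).const_mul (interpConst θ)
  filter_upwards [h2.eventually_lt_const (half_pos hε)] with n hn
  rw [dist_zero_right, norm_norm]
  refine (hup r hr0 n).trans_lt ?_
  rw [mul_add]
  linarith

end InterpolationCouple

/-! ### Multilinear forms on blocks -/

section Multilinear

variable {ι : Type*} [Fintype ι] {E : ι → Type*}
  [∀ i, NormedAddCommGroup (E i)] [∀ i, NormedSpace ℂ (E i)]

theorem ContinuousMultilinearMap.exists_norm_sub_le (u : ContinuousMultilinearMap ℂ E ℂ) {ε : ℝ}
    (hε : 0 < ε) : ∃ φ : ∀ i, E i, (∀ i, ‖φ i‖ ≤ 1) ∧ ‖u‖ - ε ≤ ‖u φ‖ := by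
  by_contra! h
  have hM : 0 ≤ ‖u‖ - ε := (norm_nonneg _).trans (h 0 (by simp)).le
  have : ‖u‖ ≤ ‖u‖ - ε := u.opNorm_le_bound hM fun φ => by
    have hφ : φ = fun i => (‖φ i‖ : ℂ) • ((‖φ i‖ : ℂ)⁻¹ • φ i) := by
      funext i
      rcases eq_or_ne (φ i) 0 with h0 | h0
      · simp [h0]
      · rw [smul_inv_smul₀ (by simpa using h0)]
    conv_lhs => rw [hφ]
    rw [u.map_smul_univ, norm_smul, mul_comm, norm_prod]
    simp only [Complex.norm_real, norm_norm]
    refine mul_le_mul_of_nonneg_right (h _ fun i => ?_).le (by positivity)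
    rw [norm_smul, norm_inv, Complex.norm_real, norm_norm]
    exact inv_mul_le_one
  linarith

theorem sum_stdAddChar_eq {N : ℕ} [NeZero N] (k l : ZMod N) :
    ∑ t : ZMod N, ZMod.stdAddChar (-(t * k)) * ZMod.stdAddChar (t * l) =
      if l = k then (N : ℂ) else 0 := by
  have := AddChar.sum_mulShift (l - k) (ZMod.isPrimitive_stdAddChar N)
  simp only [sub_eq_zero, ZMod.card] at this
  push_cast at this
  rw [← this]
  refine Finset.sum_congr rfl fun t _ => ?_
  rw [← AddChar.map_add_eq_mul]
  congr 1
  ring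

/-- Let a bounded multilinear form be evaluated at points `ψ k` that depend on `k` only in the
slots of `s`. If all unimodular combinations of the `ψ k j`, `j ∈ s`, are bounded, then so are
those of the values. -/
theorem norm_sum_diag_le [DecidableEq ι] {K : Type*} [Fintype K] [Nonempty K]
    (u : ContinuousMultilinearMap ℂ E ℂ) {A : ι → ℝ} {s : Finset ι} (hs : s.Nonempty)
    (ψ : K → ∀ j, E j) (hc : ∀ j ∉ s, ∀ k l, ψ k j = ψ l j) (hA : ∀ j ∉ s, ∀ k, ‖ψ k j‖ ≤ A j)
    (hAs : ∀ j ∈ s, ∀ ε : K → ℂ, (∀ k, ‖ε k‖ = 1) → ‖∑ k, ε k • ψ k j‖ ≤ A j)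
    (c : K → ℂ) (hc1 : ∀ k, ‖c k‖ = 1) :
    ‖∑ k, c k * u (ψ k)‖ ≤ ‖u‖ * ∏ j, A j := by
  classical
  induction hs using Finset.Nonempty.cons_induction generalizing ψ c with
  | singleton a =>
    obtain ⟨k₀⟩ := ‹Nonempty K›
    have hψ : ∀ k, ψ k = Function.update (ψ k₀) a (ψ k a) := fun k => by
      funext j
      by_cases hj : j = a
      · subst hj; simp
      · rw [Function.update_of_ne hj]; exact hc j (by simpa using hj) _ _
    have hsum : ∑ k, c k * u (ψ k) = u (Function.update (ψ k₀) a (∑ k, c k • ψ k a)) := by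
      change _ = u.toContinuousLinearMap (ψ k₀) a _
      rw [map_sum]
      refine Finset.sum_congr rfl fun k _ => ?_
      rw [map_smul, smul_eq_mul]
      conv_lhs => rw [hψ k]
      rfl
    rw [hsum]
    refine (u.le_opNorm _).trans (mul_le_mul_of_nonneg_left ?_ (norm_nonneg _))
    refine Finset.prod_le_prod (fun _ _ => norm_nonneg _) fun j _ => ?_
    by_cases hj : j = a
    · subst hj; simpa using hAs j (by simp) c hc1
    · rw [Function.update_of_ne hj]; exact hA j (by simpa using hj) _
  | cons a s ha hs ih =>
    have hN : Fintype.card K ≠ 0 := Fintype.card_ne_zero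
    have : NeZero (Fintype.card K) := ⟨hN⟩
    set N := Fintype.card K
    obtain e : K ≃ ZMod N := Fintype.equivOfCardEq (by rw [ZMod.card])
    set χ : ZMod N → ℂ := fun t => ZMod.stdAddChar t with hχ
    have hχ1 : ∀ t, ‖χ t‖ = 1 := fun t => AddChar.norm_apply _ t
    -- Slot a is filled with the character combination ∑ χ(t e l) ψ_l a, which no longer depends on
    -- k. It is one of the unimodular combinations bounded by A a, so slot a can leave s and the
    -- induction hypothesis applies.
    have hbound : ∀ t : ZMod N, ‖∑ k, (c k * χ (-(t * e k))) *
        u (Function.update (ψ k) a (∑ l, χ (t * e l) • ψ l a))‖ ≤ ‖u‖ * ∏ j, A j := by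
      intro t
      refine ih (fun k => Function.update (ψ k) a (∑ l, χ (t * e l) • ψ l a)) ?_ ?_ ?_ _ ?_
      · intro j hj k l
        by_cases hja : j = a
        · subst hja; simp
        · simp only [Function.update_of_ne hja]
          exact hc j (by simp [hja, hj]) _ _
      · intro j hj k
        by_cases hja : j = a
        · subst hja
          simpa using hAs j (by simp) _ fun k => hχ1 _
        · simp only [Function.update_of_ne hja]
          exact hA j (by simp [hja, hj]) _
      · intro j hj ε hε
        have hja : j ≠ a := fun h => ha (h ▸ hj)
        simp only [Function.update_of_ne hja]
        exact hAs j (by simp [hj]) ε hε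
      · intro k; rw [norm_mul, hc1, hχ1, one_mul]
    have hexp : ∀ k (t : ZMod N), u (Function.update (ψ k) a (∑ l, χ (t * e l) • ψ l a)) =
        ∑ l, χ (t * e l) * u (Function.update (ψ k) a (ψ l a)) := fun k t => by
      change u.toContinuousLinearMap (ψ k) a _ = _
      rw [map_sum]
      refine Finset.sum_congr rfl fun l _ => ?_
      rw [map_smul, smul_eq_mul]
      rfl
    -- Expanding slot a and summing over all t removes the terms with l ≠ k by orthogonality of
    -- characters; the terms l = k restore u (ψ k).
    have havg : (N : ℂ) * ∑ k, c k * u (ψ k) = ∑ t : ZMod N, ∑ k, (c k * χ (-(t * e k))) *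
        u (Function.update (ψ k) a (∑ l, χ (t * e l) • ψ l a)) := by
      rw [Finset.sum_comm, Finset.mul_sum]
      refine Finset.sum_congr rfl fun k _ => ?_
      simp_rw [hexp, Finset.mul_sum]
      rw [Finset.sum_comm]
      have : ∀ l, ∑ t : ZMod N, c k * χ (-(t * e k)) *
          (χ (t * e l) * u (Function.update (ψ k) a (ψ l a))) =
          if l = k then (N : ℂ) * (c k * u (ψ k)) else 0 := by
        intro l
        have h1 := sum_stdAddChar_eq (e k) (e l)
        have h2 : ∑ t : ZMod N, c k * χ (-(t * e k)) *
            (χ (t * e l) * u (Function.update (ψ k) a (ψ l a))) =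
            c k * u (Function.update (ψ k) a (ψ l a)) *
              ∑ t : ZMod N, χ (-(t * e k)) * χ (t * e l) := by
          rw [Finset.mul_sum]
          exact Finset.sum_congr rfl fun t _ => by ring
        rw [h2, h1]
        simp only [e.injective.eq_iff]
        split_ifs with hlk
        · subst hlk; rw [Function.update_eq_self]; ring
        · simp
      simp_rw [this]
      simp
    have hle : (N : ℝ) * ‖∑ k, c k * u (ψ k)‖ ≤ N * (‖u‖ * ∏ j, A j) := by
      have h1 : ‖(N : ℂ) * ∑ k, c k * u (ψ k)‖ = (N : ℝ) * ‖∑ k, c k * u (ψ k)‖ := by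
        rw [norm_mul]; simp
      rw [← h1, havg]
      refine (norm_sum_le_of_le _ fun t _ => hbound t).trans (le_of_eq ?_)
      simp [ZMod.card]
    exact le_of_mul_le_mul_left hle (by exact_mod_cast Nat.pos_of_ne_zero hN)

end Multilinear

/-! ### Tensor products of operators -/

section TensorMap

variable {ι : Type*} [Fintype ι] {X : ι → Type*}
  [∀ i, NormedAddCommGroup (X i)] [∀ i, NormedSpace ℂ (X i)]

/-- The adjoint of a bounded operator. -/
def dualMap {Y : Type*} [NormedAddCommGroup Y] [NormedSpace ℂ Y] (A : Y →L[ℂ] Y) :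
    StrongDual ℂ Y →L[ℂ] StrongDual ℂ Y :=
  (ContinuousLinearMap.compL ℂ Y Y ℂ).flip A

theorem norm_dualMap_le {Y : Type*} [NormedAddCommGroup Y] [NormedSpace ℂ Y] (A : Y →L[ℂ] Y) :
    ‖dualMap A‖ ≤ ‖A‖ :=
  ContinuousLinearMap.opNorm_le_bound _ (norm_nonneg _) fun φ => by
    rw [mul_comm]; exact ContinuousLinearMap.opNorm_comp_le φ A

/-- The tensor product of bounded operators on the completed injective tensor product. -/
def tensorMap (A : ∀ i, X i →L[ℂ] X i) : InjectiveTensor X →L[ℂ] InjectiveTensor X :=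
  ((ContinuousMultilinearMap.compContinuousLinearMapL fun i => dualMap (A i)).comp
    (injectiveTensorSubmodule X).subtypeL).codRestrict (injectiveTensorSubmodule X) fun u => by
      set L : MultilinearForms (fun i => StrongDual ℂ (X i)) →L[ℂ]
        MultilinearForms (fun i => StrongDual ℂ (X i)) :=
        ContinuousMultilinearMap.compContinuousLinearMapL fun i => dualMap (A i)
      suffices h : injectiveTensorSubmodule X ≤ (injectiveTensorSubmodule X).comap L.toLinearMap
        from h u.2
      refine Submodule.topologicalClosure_minimal _ ?_
        ((Submodule.isClosed_topologicalClosure _).preimage L.continuous)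
      rw [Submodule.span_le]
      rintro _ ⟨x, rfl⟩
      refine Submodule.le_topologicalClosure _ (Submodule.subset_span ⟨fun i => A i (x i), ?_⟩)
      ext φ
      change _ = elementaryTensor X x fun i => dualMap (A i) (φ i)
      rw [elementaryTensor_apply, elementaryTensor_apply]
      rfl

theorem tensorMap_apply (A : ∀ i, X i →L[ℂ] X i) (u : InjectiveTensor X)
    (φ : ∀ i, StrongDual ℂ (X i)) : (tensorMap A u).1 φ = u.1 fun i => (φ i).comp (A i) := rfl

theorem norm_tensorMap_le {A : ∀ i, X i →L[ℂ] X i} (hA : ∀ i, ‖A i‖ ≤ 1)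
    (u : InjectiveTensor X) : ‖tensorMap A u‖ ≤ ‖u‖ := by
  refine (ContinuousMultilinearMap.norm_compContinuousLinearMap_le u.1
    fun i => dualMap (A i)).trans (mul_le_of_le_one_right (norm_nonneg _) ?_)
  exact Finset.prod_le_one (fun _ _ => norm_nonneg _) fun i _ => (norm_dualMap_le _).trans (hA i)

variable (X) in
/-- Elementary tensors as elements of the completed tensor product. -/
def elementary (x : ∀ i, X i) : InjectiveTensor X :=
  ⟨elementaryTensor X x, Submodule.le_topologicalClosure _ (Submodule.subset_span ⟨x, rfl⟩)⟩

theorem tensorMap_elementary (A : ∀ i, X i →L[ℂ] X i) (x : ∀ i, X i) :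
    tensorMap A (elementary X x) = elementary X fun i => A i (x i) := by
  refine Subtype.ext (ContinuousMultilinearMap.ext fun φ => ?_)
  rw [tensorMap_apply]
  change elementaryTensor X x _ = elementaryTensor X _ φ
  rw [elementaryTensor_apply, elementaryTensor_apply]
  rfl

theorem continuous_elementaryTensor : Continuous (elementaryTensor X) := by
  have h : elementaryTensor X = fun x =>
      ContinuousMultilinearMap.compContinuousLinearMapContinuousMultilinear ℂ
        (fun i => StrongDual ℂ (X i)) (fun _ : ι => ℂ) ℂ
        (fun i => NormedSpace.inclusionInDoubleDual ℂ (X i) (x i))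
        (ContinuousMultilinearMap.mkPiAlgebra ℂ ι ℂ) := rfl
  rw [h]
  refine Continuous.clm_apply ?_ continuous_const
  refine (ContinuousMultilinearMap.compContinuousLinearMapContinuousMultilinear ℂ
        (fun i => StrongDual ℂ (X i)) (fun _ : ι => ℂ) ℂ).cont.comp ?_
  fun_prop

/-- Uniformly contractive operators converge strongly on a closed span as soon as they do so on the
generators; this is used with elementary tensors as generators. -/
theorem tendsto_of_mem_closure_span {Y : Type*} [NormedAddCommGroup Y] [NormedSpace ℂ Y]
    {L : ℕ → Y →L[ℂ] Y} (hL : ∀ n v, ‖L n v‖ ≤ ‖v‖) {S : Set Y}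
    (hS : ∀ v ∈ S, Tendsto (fun n => L n v) atTop (𝓝 v)) {u : Y}
    (hu : u ∈ (Submodule.span ℂ S).topologicalClosure) :
    Tendsto (fun n => L n u) atTop (𝓝 u) := by
  have hspan : ∀ v ∈ Submodule.span ℂ S, Tendsto (fun n => L n v) atTop (𝓝 v) := by
    intro v hv
    induction hv using Submodule.span_induction with
    | mem v hv => exact hS v hv
    | zero => simp
    | add v w _ _ hv hw => simpa only [map_add] using hv.add hw
    | smul c v _ hv => simpa only [map_smul] using hv.const_smul c
  rw [Metric.tendsto_atTop]
  intro ε hε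
  obtain ⟨v, hv, hvu⟩ := Metric.mem_closure_iff.1
    (show u ∈ closure (Submodule.span ℂ S : Set Y) from hu) (ε / 3) (by positivity)
  obtain ⟨n₀, hn₀⟩ := Metric.tendsto_atTop.1 (hspan v hv) (ε / 3) (by positivity)
  refine ⟨n₀, fun n hn => ?_⟩
  have h1 : dist (L n u) (L n v) ≤ dist u v := by
    rw [dist_eq_norm, ← map_sub, dist_eq_norm]
    exact hL n _
  have h2 := hn₀ n hn
  have := dist_triangle4 (L n u) (L n v) v u
  rw [dist_comm v u] at this
  linarith

theorem tendsto_tensorMap {A : ℕ → ∀ i, X i →L[ℂ] X i} (hA : ∀ n i, ‖A n i‖ ≤ 1)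
    (hlim : ∀ i x, Tendsto (fun n => A n i x) atTop (𝓝 x)) (u : InjectiveTensor X) :
    Tendsto (fun n => tensorMap (A n) u) atTop (𝓝 u) := by
  rw [tendsto_subtype_rng]
  refine tendsto_of_mem_closure_span
    (L := fun n => ContinuousMultilinearMap.compContinuousLinearMapL fun i => dualMap (A n i))
    (fun n v => ?_) ?_ u.2
  · refine (ContinuousMultilinearMap.norm_compContinuousLinearMap_le v
      fun i => dualMap (A n i)).trans (mul_le_of_le_one_right (norm_nonneg _) ?_)
    exact Finset.prod_le_one (fun _ _ => norm_nonneg _)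
      fun i _ => (norm_dualMap_le _).trans (hA n i)
  · rintro _ ⟨x, rfl⟩
    have h : Tendsto (fun n => elementaryTensor X fun i => A n i (x i)) atTop
        (𝓝 (elementaryTensor X x)) :=
      (continuous_elementaryTensor.tendsto x).comp (tendsto_pi_nhds.2 fun i => hlim i (x i))
    exact h.congr fun n => (congrArg Subtype.val (tensorMap_elementary (A n) x)).symm

end TensorMap

/-! ### Coordinate restrictions -/

section Restrict

variable (q : ℝ≥0∞) [hq1 : Fact (1 ≤ q)]

theorem norm_indicator_apply_le (D : Set ℕ) (x : ℕ → ℂ) (i : ℕ) : ‖D.indicator x i‖ ≤ ‖x i‖ :=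
  norm_indicator_le_norm_self x i

/-- Restriction of sequences to a set of coordinates. -/
def seqRestrict (D : Set ℕ) : SeqSpace q →L[ℂ] SeqSpace q :=
  LinearMap.mkContinuous
    { toFun := fun x => ⟨D.indicator x, (lp.memℓp x).mono' (norm_indicator_apply_le D x)⟩
      map_add' := fun x y => lp.ext (Set.indicator_add D (x : ℕ → ℂ) y)
      map_smul' := fun c x => lp.ext (Set.indicator_const_smul D c (x : ℕ → ℂ)) } 1 fun x => by
    rw [one_mul]
    exact lp.norm_mono (zero_lt_one.trans_le hq1.out).ne' (norm_indicator_apply_le D x)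

variable {q}

theorem seqRestrict_apply (D : Set ℕ) (x : SeqSpace q) (i : ℕ) :
    seqRestrict q D x i = D.indicator x i := rfl

variable (q) in
theorem norm_seqRestrict_le (D : Set ℕ) : ‖seqRestrict q D‖ ≤ 1 :=
  LinearMap.mkContinuous_norm_le _ zero_le_one _

theorem seqRestrict_univ (x : SeqSpace q) : seqRestrict q Set.univ x = x :=
  lp.ext (Set.indicator_univ _)

/-- The unit vectors form a basis of ℓ_q for finite q. It is only applied at p₀, so p₁ = ∞ remains
allowed. -/
theorem tendsto_seqRestrict (hq : q ≠ ⊤) (x : SeqSpace q) :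
    Tendsto (fun n : ℕ => seqRestrict q (Set.Iio n) x) atTop (𝓝 x) := by
  refine ((lp.hasSum_single hq x).comp tendsto_finset_range).congr fun n => lp.ext ?_
  funext i
  rw [seqRestrict_apply, Function.comp_apply, lp.coeFn_sum, Finset.sum_apply]
  by_cases hi : i < n
  · rw [Set.indicator_of_mem (by simpa using hi),
      Finset.sum_eq_single_of_mem i (by simpa using hi), lp.single_apply_self]
    intro j _ hj
    exact lp.single_apply_ne _ _ _ hj.symm
  · rw [Set.indicator_of_notMem (by simpa using hi)]
    refine Finset.sum_eq_zero fun j hj => lp.single_apply_ne _ _ _ ?_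
    rintro rfl
    exact hi (by simpa using hj)

theorem coordFunctional_comp_seqRestrict (D : Set ℕ) (i : ℕ) [Decidable (i ∈ D)] :
    (coordFunctional q i).comp (seqRestrict q D) = if i ∈ D then coordFunctional q i else 0 := by
  ext x
  change seqRestrict q D x i = _
  rw [seqRestrict_apply]
  split_ifs with h
  · rw [Set.indicator_of_mem h]; rfl
  · rw [Set.indicator_of_notMem h]; rfl

theorem norm_coordFunctional_le (i : ℕ) : ‖coordFunctional q i‖ ≤ 1 :=
  ContinuousLinearMap.opNorm_le_bound _ zero_le_one fun x => by
    rw [one_mul]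
    exact lp.norm_apply_le_norm (zero_lt_one.trans_le hq1.out).ne' x i

theorem sum_norm_seqRestrict_rpow_le {K : Type*} [Fintype K] (hq : q ≠ ⊤) {D : K → Set ℕ}
    (hD : Pairwise fun k l => Disjoint (D k) (D l)) (x : SeqSpace q) :
    ∑ k, ‖seqRestrict q (D k) x‖ ^ q.toReal ≤ ‖x‖ ^ q.toReal := by
  have hpos : 0 < q.toReal := ENNReal.toReal_pos (zero_lt_one.trans_le hq1.out).ne' hq
  refine hasSum_le (fun i => ?_)
    (hasSum_sum fun k _ => lp.hasSum_norm hpos (seqRestrict q (D k) x)) (lp.hasSum_norm hpos x)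
  simp only [seqRestrict_apply]
  by_cases h : ∃ k, i ∈ D k
  · obtain ⟨k, hk⟩ := h
    rw [Finset.sum_eq_single k]
    · rw [Set.indicator_of_mem hk]
    · intro l _ hl
      rw [Set.indicator_of_notMem fun hil => Set.disjoint_left.1 (hD hl) hil hk]
      simp [hpos.ne']
    · simp
  · push Not at h
    rw [Finset.sum_eq_zero fun k _ => by
      rw [Set.indicator_of_notMem (h k)]; simp [hpos.ne']]
    positivity

/-- Disjoint pieces of x have q-th powers of norms summing to at most ‖x‖^q; the power mean
inequality converts this to a first-power sum. -/
theorem sum_norm_seqRestrict_le {K : Type*} [Fintype K] [Nonempty K] (hq : q ≠ ⊤)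
    {D : K → Set ℕ} (hD : Pairwise fun k l => Disjoint (D k) (D l)) (x : SeqSpace q) :
    ∑ k, ‖seqRestrict q (D k) x‖ ≤ (Fintype.card K : ℝ) ^ (1 - q.toReal⁻¹) * ‖x‖ := by
  have hq' : 1 ≤ q.toReal := by
    simpa using ENNReal.toReal_mono hq hq1.out
  have hpos : 0 < q.toReal := by linarith
  have h := Real.rpow_sum_le_const_mul_sum_rpow Finset.univ
    (fun k => ‖seqRestrict q (D k) x‖) hq'
  simp only [abs_norm, Finset.card_univ] at h
  have hN : (0 : ℝ) < Fintype.card K := by exact_mod_cast Fintype.card_pos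
  have h2 := h.trans (mul_le_mul_of_nonneg_left (sum_norm_seqRestrict_rpow_le hq hD x)
    (Real.rpow_nonneg hN.le _))
  refine (Real.rpow_le_rpow_iff (Finset.sum_nonneg fun _ _ => norm_nonneg _)
    (by positivity) hpos).1 (h2.trans (le_of_eq ?_))
  rw [Real.mul_rpow (by positivity) (norm_nonneg _), ← Real.rpow_mul hN.le, sub_mul,
    inv_mul_cancel₀ hpos.ne', one_mul]

/-- Dual form of the preceding estimate. It supplies the bound on unimodular combinations in one
slot that `norm_sum_diag_le` requires. -/
theorem norm_sum_comp_seqRestrict_le {K : Type*} [Fintype K] [Nonempty K] (hq : q ≠ ⊤)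
    {D : K → Set ℕ} (hD : Pairwise fun k l => Disjoint (D k) (D l))
    (φ : K → StrongDual ℂ (SeqSpace q)) (hφ : ∀ k, ‖φ k‖ ≤ 1) (ε : K → ℂ)
    (hε : ∀ k, ‖ε k‖ = 1) :
    ‖∑ k, ε k • (φ k).comp (seqRestrict q (D k))‖ ≤
      (Fintype.card K : ℝ) ^ (1 - q.toReal⁻¹) := by
  refine ContinuousLinearMap.opNorm_le_bound _ (by positivity) fun x => ?_
  refine le_trans ?_ (sum_norm_seqRestrict_le hq hD x)
  rw [sum_apply]
  refine norm_sum_le_of_le _ fun k _ => ?_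
  change ‖ε k • φ k (seqRestrict q (D k) x)‖ ≤ _
  rw [norm_smul, hε, one_mul]
  exact ((φ k).le_opNorm _).trans (mul_le_of_le_one_left (norm_nonneg _) (hφ k))

variable (q) in
/-- Restriction of tensors to a box of coordinates. -/
def tensorRestrict (m : ℕ) (D : Fin m → Set ℕ) : TensorSeq m q →L[ℂ] TensorSeq m q :=
  tensorMap fun j => seqRestrict q (D j)

variable {m : ℕ}

theorem norm_tensorRestrict_le (D : Fin m → Set ℕ) (u : TensorSeq m q) :
    ‖tensorRestrict q m D u‖ ≤ ‖u‖ :=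
  norm_tensorMap_le (fun _ => norm_seqRestrict_le q _) u

/-- Restriction of arrays to a box of coordinates. -/
def arrayRestrict (D : Fin m → Set ℕ) : ((Fin m → ℕ) → ℂ) →ₗ[ℂ] ((Fin m → ℕ) → ℂ) where
  toFun a := (Set.univ.pi D).indicator a
  map_add' a b := Set.indicator_add _ a b
  map_smul' c a := Set.indicator_const_smul _ c a

theorem tensorCoeff_tensorRestrict (D : Fin m → Set ℕ) (u : TensorSeq m q) :
    tensorCoeff m q (tensorRestrict q m D u) = arrayRestrict D (tensorCoeff m q u) := by
  classical
  funext k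
  rw [tensorCoeff_apply]
  change (tensorMap _ u).1 _ = (Set.univ.pi D).indicator _ k
  rw [tensorMap_apply]
  simp only [coordFunctional_comp_seqRestrict]
  by_cases h : k ∈ Set.univ.pi D
  · rw [Set.indicator_of_mem h, tensorCoeff_apply]
    congr 1
    funext j
    exact if_pos (h j trivial)
  · rw [Set.indicator_of_notMem h]
    have : ∃ j, k j ∉ D j := by
      by_contra! h'
      exact h fun j _ => h' j
    obtain ⟨j, hj⟩ := this
    exact u.1.map_coord_zero j (if_neg hj)

theorem tendsto_tensorRestrict (hq : q ≠ ⊤) (s : Set (Fin m)) [DecidablePred (· ∈ s)]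
    (u : TensorSeq m q) :
    Tendsto (fun n : ℕ => tensorRestrict q m (fun j => if j ∈ s then Set.Iio n else Set.univ) u)
      atTop (𝓝 u) := by
  refine tendsto_tensorMap (fun n j => norm_seqRestrict_le q _) (fun j x => ?_) u
  by_cases hj : j ∈ s
  · simpa [hj] using tendsto_seqRestrict hq x
  · simp [hj, seqRestrict_univ]

theorem exists_norm_one_mul_eq (z : ℂ) : ∃ c : ℂ, ‖c‖ = 1 ∧ c * z = ‖z‖ := by
  rcases eq_or_ne z 0 with rfl | hz
  · exact ⟨1, by simp, by simp⟩
  · refine ⟨‖z‖ / z, ?_, div_mul_cancel₀ _ hz⟩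
    rw [norm_div, Complex.norm_real, norm_norm, div_self (by simpa using hz)]

/-- Lower estimate for block restrictions: the blocks are disjoint in the slots of `s`, while the
other slots are frozen to a single coordinate. -/
theorem sum_norm_tensorRestrict_le {K : Type*} [Fintype K] [Nonempty K] (hq : q ≠ ⊤)
    {s : Finset (Fin m)} (hs : s.Nonempty) {D : K → Fin m → Set ℕ}
    (hD : ∀ j ∈ s, Pairwise fun k l => Disjoint (D k j) (D l j)) {i : Fin m → ℕ}
    (hi : ∀ j ∉ s, ∀ k, D k j = {i j}) (u : TensorSeq m q) :
    ∑ k, ‖tensorRestrict q m (D k) u‖ ≤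
      (Fintype.card K : ℝ) ^ (m * (1 - q.toReal⁻¹)) * ‖u‖ := by
  classical
  have hq' : 1 ≤ q.toReal := by simpa using ENNReal.toReal_mono hq hq1.out
  have hN1 : (1 : ℝ) ≤ Fintype.card K := by exact_mod_cast Fintype.card_pos (α := K)
  have hN : (0 : ℝ) < Fintype.card K := by linarith
  have hex : 0 ≤ 1 - q.toReal⁻¹ := sub_nonneg.2 (inv_le_one_of_one_le₀ hq')
  refine le_of_forall_pos_le_add fun δ hδ => ?_
  choose φ hφ hφu using fun k => (tensorRestrict q m (D k) u).1.exists_norm_sub_le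
    (show 0 < δ / Fintype.card K by positivity)
  -- Outside s the box is the single index i j, so the near-norming functional restricted to it is a
  -- scalar multiple of a coordinate functional that does not depend on k. The scalar, of modulus at
  -- most 1, goes into γ, and ψ varies with k only in the slots of s.
  set ψ : K → ∀ _ : Fin m, StrongDual ℂ (SeqSpace q) := fun k j =>
    if j ∈ s then (φ k j).comp (seqRestrict q (D k j)) else coordFunctional q (i j) with hψ
  set γ : K → Fin m → ℂ := fun k j =>
    if j ∈ s then 1 else φ k j (lp.single q (i j) (1 : ℂ)) with hγ
  have hγψ : ∀ k, (fun j => (φ k j).comp (seqRestrict q (D k j))) = fun j => γ k j • ψ k j := by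
    intro k
    funext j
    by_cases hj : j ∈ s
    · simp [hγ, hψ, hj]
    · ext x
      have : seqRestrict q (D k j) x = x (i j) • lp.single q (i j) (1 : ℂ) := by
        refine lp.ext (funext fun l => ?_)
        rw [seqRestrict_apply, hi j hj]
        by_cases hl : l = i j
        · subst hl; simp
        · rw [Set.indicator_of_notMem (by simpa using hl), lp.coeFn_smul, Pi.smul_apply,
            lp.single_apply_ne _ _ _ hl, smul_zero]
      change φ k j (seqRestrict q (D k j) x) = _
      rw [this, map_smul]
      simp only [hγ, hψ, if_neg hj]
      exact mul_comm _ _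
  have hγ1 : ∀ k j, ‖γ k j‖ ≤ 1 := by
    intro k j
    by_cases hj : j ∈ s
    · simp [hγ, hj]
    · simp only [hγ, if_neg hj]
      refine ((φ k j).le_opNorm _).trans (mul_le_one₀ (hφ k j) (norm_nonneg _) ?_)
      rw [lp.norm_single (zero_lt_one.trans_le hq1.out)]
      simp
  have hval : ∀ k, ‖tensorRestrict q m (D k) u‖ - δ / Fintype.card K ≤ ‖u.1 (ψ k)‖ := by
    intro k
    refine (hφu k).trans ?_
    have : (tensorRestrict q m (D k) u).1 (φ k) = u.1 fun j => γ k j • ψ k j := by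
      rw [← hγψ]; rfl
    rw [this, u.1.map_smul_univ, norm_smul, norm_prod]
    exact mul_le_of_le_one_left (norm_nonneg _)
      (Finset.prod_le_one (fun _ _ => norm_nonneg _) fun j _ => hγ1 k j)
  choose c hc hcu using fun k => exists_norm_one_mul_eq (u.1 (ψ k))
  have hmain := norm_sum_diag_le u.1
    (A := fun j => if j ∈ s then (Fintype.card K : ℝ) ^ (1 - q.toReal⁻¹) else 1) hs ψ
    (fun j hj k l => by simp [hψ, hj])
    (fun j hj k => by simpa [hψ, hj] using norm_coordFunctional_le (q := q) (i j))
    (fun j hj ε hε => by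
      simp only [hψ, hj, if_true]
      exact norm_sum_comp_seqRestrict_le hq (hD j hj) (fun k => φ k j) (fun k => hφ k j) ε hε)
    c hc
  simp_rw [hcu] at hmain
  rw [← Complex.ofReal_sum, Complex.norm_real,
    Real.norm_of_nonneg (Finset.sum_nonneg fun _ _ => norm_nonneg _)] at hmain
  -- The slots outside s contribute 1, here enlarged to the same power of the cardinality as the
  -- others, so that the exponent m(1 - 1/q) is the same for every s.
  have hprod : ∏ j : Fin m, (if j ∈ s then (Fintype.card K : ℝ) ^ (1 - q.toReal⁻¹) else 1) ≤
      (Fintype.card K : ℝ) ^ (m * (1 - q.toReal⁻¹)) := by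
    refine (Finset.prod_le_prod (fun j _ => ?_) fun j _ => ?_).trans (le_of_eq ?_)
      (b := ∏ _j : Fin m, (Fintype.card K : ℝ) ^ (1 - q.toReal⁻¹))
    · split_ifs <;> positivity
    · split_ifs
      · exact le_rfl
      · exact Real.one_le_rpow hN1 hex
    · rw [Finset.prod_const, Finset.card_univ, Fintype.card_fin, mul_comm, Real.rpow_mul hN.le,
        Real.rpow_natCast]
  have hsum : ∑ k, ‖tensorRestrict q m (D k) u‖ - δ ≤ ∑ k, ‖u.1 (ψ k)‖ := by
    refine le_trans (le_of_eq ?_) (Finset.sum_le_sum fun k _ => hval k)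
    rw [Finset.sum_sub_distrib]
    simp
    field_simp
  have : ‖u.1‖ * ∏ j : Fin m, (if j ∈ s then (Fintype.card K : ℝ) ^ (1 - q.toReal⁻¹) else 1) ≤
      (Fintype.card K : ℝ) ^ (m * (1 - q.toReal⁻¹)) * ‖u‖ := by
    rw [mul_comm]
    exact mul_le_mul_of_nonneg_right hprod (norm_nonneg _)
  linarith

end Restrict

/-! ### The diagonal of the injective tensor product -/

section Diagonal

variable {p : ℝ≥0∞} [hp1 : Fact (1 ≤ p)]

/-- The values of a functional on the unit vectors of `ℓ_p` lie in the dual sequence space. -/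
theorem sum_norm_apply_single_rpow_le {r : ℝ} (hr : p.toReal.HolderConjugate r)
    (φ : StrongDual ℂ (SeqSpace p)) (F : Finset ℕ) :
    ∑ l ∈ F, ‖φ (lp.single p l (1 : ℂ))‖ ^ r ≤ ‖φ‖ ^ r := by
  choose c hc hcφ using fun l => exists_norm_one_mul_eq (φ (lp.single p l (1 : ℂ)))
  set t : ℕ → ℝ := fun l => ‖φ (lp.single p l (1 : ℂ))‖ with ht
  set S := ∑ l ∈ F, t l ^ r with hS
  have ht0 : ∀ l, 0 ≤ t l := fun l => norm_nonneg _
  have hS0 : 0 ≤ S := Finset.sum_nonneg fun l _ => Real.rpow_nonneg (ht0 l) r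
  have hrpos := hr.symm.pos
  rcases hS0.eq_or_lt with h0 | hSpos
  · rw [← h0]; positivity
  -- The equality case of Hölder's inequality: moduli t_l^(r-1) with the phases c_l give φ x = S and
  -- ‖x‖^p = S.
  set x : SeqSpace p := ∑ l ∈ F, lp.single p l (((t l ^ (r - 1) : ℝ) : ℂ) * c l) with hx
  have hφx : φ x = (S : ℂ) := by
    rw [hx, map_sum, hS, Complex.ofReal_sum]
    refine Finset.sum_congr rfl fun l _ => ?_
    have : lp.single (E := fun _ : ℕ => ℂ) p l (((t l ^ (r - 1) : ℝ) : ℂ) * c l) =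
        (((t l ^ (r - 1) : ℝ) : ℂ) * c l) • lp.single (E := fun _ : ℕ => ℂ) p l (1 : ℂ) := by
      rw [← lp.single_smul, smul_eq_mul, mul_one]
    rw [this, map_smul, smul_eq_mul, mul_assoc, hcφ, ← Complex.ofReal_mul]
    congr 1
    change t l ^ (r - 1) * t l = _
    rcases (ht0 l).eq_or_lt with h | h
    · rw [← h, mul_zero, Real.zero_rpow hrpos.ne']
    · rw [← Real.rpow_add_one h.ne', sub_add_cancel]
  have hxn : ‖x‖ ^ p.toReal = S := by
    have := lp.norm_sum_single hr.pos (fun l => ((t l ^ (r - 1) : ℝ) : ℂ) * c l) F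
    rw [hx, this, hS]
    refine Finset.sum_congr rfl fun l _ => ?_
    rw [norm_mul, hc, mul_one, Complex.norm_real,
      Real.norm_of_nonneg (Real.rpow_nonneg (ht0 l) _), ← Real.rpow_mul (ht0 l),
      hr.symm.sub_one_mul_conj]
  have hxn' : ‖x‖ = S ^ (p.toReal)⁻¹ := by
    rw [← hxn, Real.rpow_rpow_inv (norm_nonneg _) hr.ne_zero]
  have h1 : S ≤ ‖φ‖ * S ^ (p.toReal)⁻¹ := by
    have := φ.le_opNorm x
    rwa [hφx, Complex.norm_real, Real.norm_of_nonneg hS0, hxn'] at this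
  have h2 : S ^ r⁻¹ ≤ ‖φ‖ := by
    have h3 : S = S ^ r⁻¹ * S ^ (p.toReal)⁻¹ := by
      rw [← Real.rpow_add hSpos, add_comm, hr.inv_add_inv_eq_one, Real.rpow_one]
    refine le_of_mul_le_mul_right (a := S ^ (p.toReal)⁻¹) ?_ (Real.rpow_pos_of_pos hSpos _)
    rwa [← h3]
  calc S = (S ^ r⁻¹) ^ r := (Real.rpow_inv_rpow hS0 hrpos.ne').symm
    _ ≤ ‖φ‖ ^ r := Real.rpow_le_rpow (by positivity) h2 hrpos.le

/-- If r ≤ m, every t_l is at most 1, so t_l^m ≤ t_l^r and the sum is at most 1. If m ≤ r, the power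
mean inequality with exponent r/m gives the power 1 - m/r of the cardinality. -/
theorem sum_pow_le_card_rpow {r : ℝ} (hr : 0 < r) {m : ℕ} (hm : m ≠ 0) (F : Finset ℕ) {t : ℕ → ℝ}
    (ht : ∀ l, 0 ≤ t l) (hsum : ∑ l ∈ F, t l ^ r ≤ 1) :
    ∑ l ∈ F, t l ^ m ≤ (F.card : ℝ) ^ max 0 (1 - m * r⁻¹) := by
  rcases F.eq_empty_or_nonempty with rfl | hF
  · rw [Finset.sum_empty]
    positivity
  have hN : (1 : ℝ) ≤ F.card := by exact_mod_cast hF.card_pos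
  have hN0 : (0 : ℝ) < F.card := by linarith
  have hm0 : (0 : ℝ) < m := by exact_mod_cast Nat.pos_of_ne_zero hm
  rcases le_total r m with h | h
  · have ht1 : ∀ l ∈ F, t l ≤ 1 := fun l hl => by
      have h1 : t l ^ r ≤ 1 := (Finset.single_le_sum (f := fun l => t l ^ r)
        (fun l _ => Real.rpow_nonneg (ht l) r) hl).trans hsum
      by_contra! h2
      exact absurd h1 (not_le.2 (Real.one_lt_rpow h2 hr))
    calc ∑ l ∈ F, t l ^ m ≤ ∑ l ∈ F, t l ^ r := by
          refine Finset.sum_le_sum fun l hl => ?_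
          rcases (ht l).eq_or_lt with h0 | h0
          · rw [← h0, zero_pow hm, Real.zero_rpow hr.ne']
          · rw [← Real.rpow_natCast]
            exact Real.rpow_le_rpow_of_exponent_ge h0 (ht1 l hl) h
      _ ≤ 1 := hsum
      _ ≤ _ := Real.one_le_rpow hN (le_max_left _ _)
  · have h1 : 1 ≤ r / m := (one_le_div hm0).2 h
    have h2 := Real.rpow_sum_le_const_mul_sum_rpow F (fun l => t l ^ m) h1
    simp only [abs_of_nonneg (pow_nonneg (ht _) m)] at h2
    have h3 : ∀ l, (t l ^ m) ^ (r / m) = t l ^ r := fun l => by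
      rw [← Real.rpow_natCast, ← Real.rpow_mul (ht l), mul_div_cancel₀ _ hm0.ne']
    simp_rw [h3] at h2
    have hA : 0 ≤ ∑ l ∈ F, t l ^ m := Finset.sum_nonneg fun l _ => pow_nonneg (ht l) m
    have h4 : (∑ l ∈ F, t l ^ m) ^ (r / m) ≤ ((F.card : ℝ) ^ (1 - m * r⁻¹)) ^ (r / m) := by
      refine (h2.trans (mul_le_of_le_one_right (by positivity) hsum)).trans (le_of_eq ?_)
      rw [← Real.rpow_mul hN0.le]
      congr 1
      field_simp
    refine ((Real.rpow_le_rpow_iff hA (by positivity) (by positivity)).1 h4).trans ?_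
    exact Real.rpow_le_rpow_of_exponent_le hN (le_max_right _ _)

/-- The `l`-th diagonal unit vector `e_l ⊗ ⋯ ⊗ e_l`. -/
def diagVector (m : ℕ) (p : ℝ≥0∞) [Fact (1 ≤ p)] (l : ℕ) : TensorSeq m p :=
  elementary _ fun _ : Fin m => lp.single p l (1 : ℂ)

theorem diagVector_apply (m l : ℕ) (φ : Fin m → StrongDual ℂ (SeqSpace p)) :
    (diagVector m p l).1 φ = ∏ j, φ j (lp.single p l (1 : ℂ)) :=
  elementaryTensor_apply _ _ _

theorem one_le_norm_diagVector (m l : ℕ) : 1 ≤ ‖diagVector m p l‖ := by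
  have h := (diagVector m p l).1.le_opNorm fun _ => coordFunctional p l
  rw [diagVector_apply] at h
  have h1 : coordFunctional p l (lp.single p l (1 : ℂ)) = 1 :=
    lp.single_apply_self (E := fun _ : ℕ => ℂ) p l (1 : ℂ)
  simp only [h1, Finset.prod_const_one, norm_one] at h
  refine h.trans (mul_le_of_le_one_right (norm_nonneg _) ?_)
  exact Finset.prod_le_one (fun _ _ => norm_nonneg _) fun _ _ => norm_coordFunctional_le l

/-- On functionals of norm one the value is a sum of products over the slots. The
arithmetic-geometric mean inequality reduces it to sums of m-th powers of one functional on the unit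
vectors, and those values lie in the unit ball of the dual sequence space ℓ_r. -/
theorem norm_sum_diagVector_le {m : ℕ} (hm : m ≠ 0) {r : ℝ} (hr : p.toReal.HolderConjugate r)
    (F : Finset ℕ) (c : ℕ → ℂ) (hc : ∀ l, ‖c l‖ = 1) :
    ‖∑ l ∈ F, c l • diagVector m p l‖ ≤ (F.card : ℝ) ^ max 0 (1 - m * r⁻¹) := by
  have hrpos := hr.symm.pos
  have hm0 : (0 : ℝ) < m := by exact_mod_cast Nat.pos_of_ne_zero hm
  refine ContinuousMultilinearMap.opNorm_le_bound (by positivity) fun φ => ?_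
  have hval : (∑ l ∈ F, c l • diagVector m p l).1 φ =
      ∑ l ∈ F, c l * ∏ j, φ j (lp.single p l (1 : ℂ)) := by
    rw [Submodule.coe_sum, sum_apply]
    refine Finset.sum_congr rfl fun l _ => ?_
    rw [← diagVector_apply]
    rfl
  refine (congrArg norm hval).le.trans ?_
  set t : Fin m → ℕ → ℝ := fun j l => ‖φ j (lp.single p l (1 : ℂ))‖ / ‖φ j‖ with ht
  have ht0 : ∀ j l, 0 ≤ t j l := fun j l => by positivity
  have htφ : ∀ j l, ‖φ j (lp.single p l (1 : ℂ))‖ = t j l * ‖φ j‖ := fun j l => by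
    rcases eq_or_ne (φ j) 0 with h | h
    · simp [h]
    · rw [div_mul_cancel₀ _ (norm_ne_zero_iff.2 h)]
  have htsum : ∀ j, ∑ l ∈ F, t j l ^ r ≤ 1 := fun j => by
    have := sum_norm_apply_single_rpow_le hr (φ j) F
    simp_rw [ht, Real.div_rpow (norm_nonneg _) (norm_nonneg _)]
    rw [← Finset.sum_div]
    exact div_le_one_of_le₀ this (by positivity)
  have hamgm : ∀ l, ∏ j, t j l ≤ ∑ j, (m : ℝ)⁻¹ * t j l ^ m := fun l => by
    have := Real.geom_mean_le_arith_mean_weighted (Finset.univ : Finset (Fin m))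
      (fun _ => (m : ℝ)⁻¹) (fun j => t j l ^ m) (fun _ _ => by positivity)
      (by simp [hm0.ne']) (fun j _ => pow_nonneg (ht0 j l) m)
    refine le_trans (le_of_eq (Finset.prod_congr rfl fun j _ => ?_)) this
    rw [Real.pow_rpow_inv_natCast (ht0 j l) hm]
  calc ‖∑ l ∈ F, c l * ∏ j, φ j (lp.single p l (1 : ℂ))‖
      ≤ ∑ l ∈ F, (∏ j, t j l) * ∏ j, ‖φ j‖ := by
        refine norm_sum_le_of_le _ fun l _ => ?_
        rw [norm_mul, hc, one_mul, norm_prod, ← Finset.prod_mul_distrib]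
        exact (Finset.prod_congr rfl fun j _ => htφ j l).le
    _ = (∑ l ∈ F, ∏ j, t j l) * ∏ j, ‖φ j‖ := (Finset.sum_mul _ _ _).symm
    _ ≤ _ := by
        refine mul_le_mul_of_nonneg_right ?_ (by positivity)
        refine (Finset.sum_le_sum fun l _ => hamgm l).trans ?_
        rw [Finset.sum_comm]
        simp_rw [← Finset.mul_sum]
        refine (mul_le_mul_of_nonneg_left (Finset.sum_le_sum fun j _ =>
          sum_pow_le_card_rpow hrpos hm F (ht0 j) (htsum j)) (by positivity)).trans ?_
        rw [Finset.sum_const, Finset.card_univ, Fintype.card_fin, nsmul_eq_mul, ← mul_assoc,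
          inv_mul_cancel₀ hm0.ne', one_mul]

end Diagonal

/-! ### A gliding hump argument for spaces of arrays -/

/-- The source of both contradictions below: linear growth cannot be bounded by a power with
exponent below one. -/
theorem not_forall_mul_le_rpow {c B τ : ℝ} (hc : 0 < c) (hτ : τ < 1) :
    ¬ ∀ N : ℕ, 0 < N → c * N ≤ B * (N : ℝ) ^ τ := by
  intro h
  have hlim : Tendsto (fun N : ℕ => B * (N : ℝ) ^ (τ - 1)) atTop (𝓝 0) := by
    have h1 := (tendsto_rpow_neg_atTop (show 0 < 1 - τ by linarith)).comp
      (tendsto_natCast_atTop_atTop (R := ℝ))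
    simpa using h1.const_mul B
  obtain ⟨N, hN, hN0⟩ := ((hlim.eventually_lt_const hc).and (eventually_gt_atTop 0)).exists
  have hNr : (0 : ℝ) < N := by exact_mod_cast hN0
  have h1 := h N hN0
  rw [Real.rpow_sub_one hNr.ne', mul_div_assoc', div_lt_iff₀ hNr] at hN
  linarith

section GlidingHump

variable {m : ℕ} {W : Type*} [SeminormedAddCommGroup W] [NormedSpace ℂ W]

/-- A space of arrays indexed by `ℕᵐ` on which the restrictions to boxes act boundedly. -/
structure ArraySpace (m : ℕ) (W : Type*) [SeminormedAddCommGroup W] [NormedSpace ℂ W] where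
  /-- The array of an element. -/
  coeff : W →ₗ[ℂ] ((Fin m → ℕ) → ℂ)
  injective : Function.Injective coeff
  /-- The restriction to a box. -/
  restrict : (Fin m → Set ℕ) → W →ₗ[ℂ] W
  coeff_restrict : ∀ D w, coeff (restrict D w) = arrayRestrict D (coeff w)
  /-- A bound for the restrictions. -/
  bound : ℝ
  one_le_bound : 1 ≤ bound
  norm_restrict_le : ∀ D w, ‖restrict D w‖ ≤ bound * ‖w‖

namespace ArraySpace

variable (S : ArraySpace m W)

theorem bound_pos : 0 < S.bound := zero_lt_one.trans_le S.one_le_bound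

theorem restrict_restrict (D D' : Fin m → Set ℕ) (w : W) :
    S.restrict D (S.restrict D' w) = S.restrict (fun j => D j ∩ D' j) w := by
  refine S.injective ?_
  rw [S.coeff_restrict, S.coeff_restrict, S.coeff_restrict]
  change (Set.univ.pi D).indicator ((Set.univ.pi D').indicator _) = Set.indicator _ _
  rw [Set.indicator_indicator]
  congr 1
  ext k
  simp only [Set.mem_inter_iff, Set.mem_pi, Set.mem_univ, true_implies]
  exact forall_and.symm

theorem restrict_univ (w : W) : S.restrict (fun _ => Set.univ) w = w := by
  refine S.injective ?_
  rw [S.coeff_restrict]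
  change Set.indicator _ _ = _
  rw [Set.pi_univ, Set.indicator_univ]

theorem restrict_eq_zero {D : Fin m → Set ℕ} {a : Fin m} (h : D a = ∅) (w : W) :
    S.restrict D w = 0 := by
  refine S.injective ?_
  rw [S.coeff_restrict, map_zero]
  change Set.indicator _ _ = _
  rw [Set.univ_pi_eq_empty h, Set.indicator_empty]
  rfl

theorem restrict_update_union (D : Fin m → Set ℕ) (a : Fin m) {A B : Set ℕ} (h : Disjoint A B)
    (w : W) : S.restrict (Function.update D a (A ∪ B)) w =
      S.restrict (Function.update D a A) w + S.restrict (Function.update D a B) w := by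
  refine S.injective ?_
  rw [map_add, S.coeff_restrict, S.coeff_restrict, S.coeff_restrict]
  change Set.indicator _ _ = Set.indicator _ _ + Set.indicator _ _
  have hpi : ∀ E : Set ℕ, Set.univ.pi (Function.update D a E) =
      {k | k a ∈ E ∧ ∀ j ≠ a, k j ∈ D j} := fun E => by
    ext k
    simp only [Set.mem_pi, Set.mem_univ, true_implies, Set.mem_ofPred_eq]
    constructor
    · intro hk
      refine ⟨by simpa using hk a, fun j hj => by simpa [Function.update_of_ne hj] using hk j⟩
    · rintro ⟨h1, h2⟩ j
      by_cases hj : j = a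
      · subst hj; simpa using h1
      · simpa [Function.update_of_ne hj] using h2 j hj
  have hunion : Set.univ.pi (Function.update D a (A ∪ B)) =
      Set.univ.pi (Function.update D a A) ∪ Set.univ.pi (Function.update D a B) := by
    rw [hpi, hpi, hpi]
    ext k
    simp only [Set.mem_ofPred_eq, Set.mem_union]
    tauto
  rw [hunion, Set.indicator_union_of_disjoint]
  · rfl
  · rw [hpi, hpi, Set.disjoint_left]
    exact fun k hk hk' => Set.disjoint_left.1 h hk.1 hk'.1

/-- The restriction to a single coordinate has rank at most one. -/
theorem exists_restrict_singleton_eq (i : Fin m → ℕ) :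
    ∃ e : W, ∀ w, S.restrict (fun j => {i j}) w = S.coeff w i • e := by
  have hval : ∀ w, S.coeff (S.restrict (fun j => {i j}) w) = S.coeff w i • Pi.single i 1 := by
    intro w
    rw [S.coeff_restrict]
    change Set.indicator _ _ = _
    rw [Set.univ_pi_singleton]
    funext k
    by_cases hk : k = i
    · subst hk; simp
    · rw [Set.indicator_of_notMem (by simpa using hk)]
      simp [Pi.single_eq_of_ne hk]
  by_cases h : ∃ w, S.coeff w i ≠ 0
  · obtain ⟨w₀, hw₀⟩ := h
    refine ⟨(S.coeff w₀ i)⁻¹ • S.restrict (fun j => {i j}) w₀, fun w => S.injective ?_⟩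
    rw [hval, map_smul, map_smul, hval, inv_smul_smul₀ hw₀]
  · push Not at h
    refine ⟨0, fun w => S.injective ?_⟩
    rw [hval, h, zero_smul, smul_zero, map_zero]

variable {S} {u : ℕ → W}

/-- If signed sums of `n` vectors grow more slowly than `n`, their coordinates tend to zero. -/
theorem tendsto_restrict_singleton {B ρ : ℝ} (hρ : ρ < 1)
    (hup : ∀ (F : Finset ℕ) (c : ℕ → ℂ), (∀ l, ‖c l‖ = 1) →
      ‖∑ l ∈ F, c l • u l‖ ≤ B * (F.card : ℝ) ^ ρ) (i : Fin m → ℕ) :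
    Tendsto (fun l => ‖S.restrict (fun j => {i j}) (u l)‖) atTop (𝓝 0) := by
  obtain ⟨e, he⟩ := S.exists_restrict_singleton_eq i
  have hfin : ∀ η > 0, {l | η ≤ ‖S.restrict (fun j => {i j}) (u l)‖}.Finite := by
    intro η hη
    by_contra hinf
    refine not_forall_mul_le_rpow (B := S.bound * B) hη hρ fun N _ => ?_
    obtain ⟨F, hF, hFc⟩ := Set.Infinite.exists_subset_card_eq hinf N
    choose c hc hcu using fun l => exists_norm_one_mul_eq (S.coeff (u l) i)
    -- Restriction to a single coordinate has rank at most one, so all the pieces are multiples of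
    -- one vector e; with the phases c_l aligned, their norms add up exactly.
    have hsum : ∑ l ∈ F, ‖S.restrict (fun j => {i j}) (u l)‖ =
        ‖S.restrict (fun j => {i j}) (∑ l ∈ F, c l • u l)‖ := by
      simp_rw [he, norm_smul]
      rw [← Finset.sum_mul, map_sum, Finset.sum_apply]
      simp only [map_smul, Pi.smul_apply, smul_eq_mul, hcu]
      rw [← Complex.ofReal_sum, Complex.norm_real,
        Real.norm_of_nonneg (Finset.sum_nonneg fun _ _ => norm_nonneg _)]
    calc η * N = ∑ _l ∈ F, η := by rw [Finset.sum_const, hFc, nsmul_eq_mul, mul_comm]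
      _ ≤ ∑ l ∈ F, ‖S.restrict (fun j => {i j}) (u l)‖ := Finset.sum_le_sum fun l hl => hF hl
      _ ≤ S.bound * (B * (N : ℝ) ^ ρ) := by
        rw [hsum, ← hFc]
        exact (S.norm_restrict_le _ _).trans
          (mul_le_mul_of_nonneg_left (hup F c hc) S.bound_pos.le)
      _ = _ := (mul_assoc _ _ _).symm
  rw [Metric.tendsto_atTop]
  intro η hη
  obtain ⟨n₀, hn₀⟩ := (hfin η hη).bddAbove
  refine ⟨n₀ + 1, fun l hl => ?_⟩
  rw [dist_zero_right, norm_norm]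
  by_contra! h
  have := hn₀ h
  omega

/-- The slots outside `s` frozen at `i`, those of `s` restricted to `A`. -/
def slotBox (s : Finset (Fin m)) (i : Fin m → ℕ) (A : Set ℕ) : Fin m → Set ℕ :=
  fun j => if j ∈ s then A else {i j}

/-- A minimal set of slots that carries a nonvanishing part of the sequence. -/
theorem exists_minimal_slots {δ : ℝ} (hδ : 0 < δ) (hu : ∀ l, δ ≤ ‖u l‖)
    (hsing : ∀ i : Fin m → ℕ, Tendsto (fun l => ‖S.restrict (fun j => {i j}) (u l)‖) atTop (𝓝 0)) :
    ∃ (s : Finset (Fin m)) (i : Fin m → ℕ), s.Nonempty ∧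
      (¬ Tendsto (fun l => ‖S.restrict (slotBox s i Set.univ) (u l)‖) atTop (𝓝 0)) ∧
      ∀ t ⊂ s, ∀ i' : Fin m → ℕ,
        Tendsto (fun l => ‖S.restrict (slotBox t i' Set.univ) (u l)‖) atTop (𝓝 0) := by
  set P : Finset (Fin m) → Prop := fun s => ∃ i : Fin m → ℕ,
    ¬ Tendsto (fun l => ‖S.restrict (slotBox s i Set.univ) (u l)‖) atTop (𝓝 0) with hP
  have huniv : P Finset.univ := by
    refine ⟨0, fun h => ?_⟩
    have : slotBox (Finset.univ : Finset (Fin m)) 0 Set.univ = fun _ => Set.univ := by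
      funext j; simp [slotBox]
    simp only [this, S.restrict_univ] at h
    obtain ⟨l, hl⟩ := (h.eventually_lt_const hδ).exists
    exact absurd (hu l) (not_le.2 hl)
  obtain ⟨s, hs⟩ := exists_minimal_of_wellFoundedLT P ⟨_, huniv⟩
  obtain ⟨i, hi⟩ := hs.prop
  refine ⟨s, i, ?_, hi, fun t ht i' => ?_⟩
  · rw [Finset.nonempty_iff_ne_empty]
    rintro rfl
    refine hi ?_
    have : slotBox (∅ : Finset (Fin m)) i Set.univ = fun j => {i j} := by
      funext j; simp [slotBox]
    rw [this]
    exact hsing i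
  · by_contra h
    exact hs.not_prop_of_lt ht ⟨i', h⟩

variable {s : Finset (Fin m)} {i : Fin m → ℕ}

/-- Freezing one more slot to finitely many values makes the sequence tend to zero. -/
theorem tendsto_restrict_update_finite
    (hmin : ∀ t ⊂ s, ∀ i' : Fin m → ℕ,
      Tendsto (fun l => ‖S.restrict (slotBox t i' Set.univ) (u l)‖) atTop (𝓝 0))
    {D : Fin m → Set ℕ} (hD : ∀ j ∉ s, D j = {i j}) {a : Fin m} (ha : a ∈ s) (E : Finset ℕ) :
    Tendsto (fun l => ‖S.restrict (Function.update D a (E : Set ℕ)) (u l)‖) atTop (𝓝 0) := by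
  induction E using Finset.induction_on with
  | empty =>
    simp only [Finset.coe_empty]
    simp [S.restrict_eq_zero (D := Function.update D a ∅) (a := a) (by simp)]
  | insert b E hb ih =>
    -- Freezing slot a at b leaves the proper subset `s.erase a` of free slots, where minimality
    -- applies. The box at hand lies inside the corresponding slot box, so restricting further costs
    -- only the factor `S.bound`.
    have hstep : Tendsto (fun l => ‖S.restrict (Function.update D a {b}) (u l)‖) atTop (𝓝 0) := by
      have h := (hmin (s.erase a) (Finset.erase_ssubset ha) (Function.update i a b)).const_mul
        S.bound
      rw [mul_zero] at h
      refine squeeze_zero (fun _ => norm_nonneg _) (fun l => ?_) h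
      have heq : S.restrict (Function.update D a {b}) (u l) =
          S.restrict (Function.update D a {b})
            (S.restrict (slotBox (s.erase a) (Function.update i a b) Set.univ) (u l)) := by
        rw [S.restrict_restrict]
        congr 1
        congr 1
        funext j
        by_cases hj : j = a
        · subst hj; simp [slotBox]
        · by_cases hjs : j ∈ s
          · simp [slotBox, hj, hjs]
          · simp [slotBox, hj, hjs, hD j hjs]
      rw [heq]
      exact S.norm_restrict_le _ _
    have hsum := ih.add hstep
    rw [add_zero] at hsum
    refine squeeze_zero (fun _ => norm_nonneg _) (fun l => ?_) hsum
    rw [Finset.coe_insert, Set.insert_eq, Set.union_comm, S.restrict_update_union _ _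
      (by simpa using hb)]
    exact norm_add_le _ _

/-- Cutting off finitely many coordinates in the slots of `s` does not matter in the limit. -/
theorem tendsto_restrict_sub
    (hmin : ∀ t ⊂ s, ∀ i' : Fin m → ℕ,
      Tendsto (fun l => ‖S.restrict (slotBox t i' Set.univ) (u l)‖) atTop (𝓝 0)) (n : ℕ) :
    Tendsto (fun l => ‖S.restrict (slotBox s i (Set.Ici n)) (u l) -
      S.restrict (slotBox s i Set.univ) (u l)‖) atTop (𝓝 0) := by
  -- Interpolates between the two boxes: the slots in t are already cut off below n. Adding one slot
  -- to t changes the restriction by the part with that slot in the finite set of indices below n,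
  -- which tends to zero.
  set T : Finset (Fin m) → Fin m → Set ℕ := fun t j =>
    if j ∈ t then Set.Ici n else slotBox s i Set.univ j with hT
  have key : ∀ t ⊆ s, Tendsto (fun l => ‖S.restrict (T t) (u l) -
      S.restrict (slotBox s i Set.univ) (u l)‖) atTop (𝓝 0) := by
    intro t
    induction t using Finset.induction_on with
    | empty => intro _; simp [hT]
    | insert a t ha ih =>
      intro hts
      have has : a ∈ s := hts (Finset.mem_insert_self _ _)
      have ht : t ⊆ s := fun j hj => hts (Finset.mem_insert_of_mem hj)
      have hD : ∀ j ∉ s, T t j = {i j} := fun j hj => by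
        have : j ∉ t := fun h => hj (ht h)
        simp [hT, slotBox, hj, this]
      have h1 := tendsto_restrict_update_finite (S := S) hmin hD has (Finset.range n)
      have h2 := h1.add (ih ht)
      rw [add_zero] at h2
      refine squeeze_zero (fun _ => norm_nonneg _) (fun l => ?_) h2
      have e1 : T (insert a t) = Function.update (T t) a (Set.Ici n) := by
        funext j
        by_cases hj : j = a
        · subst hj; simp [hT]
        · simp [hT, hj]
      have e2 : T t = Function.update (T t) a (Set.Ici n ∪ (Finset.range n : Set ℕ)) := by
        funext j
        by_cases hj : j = a
        · subst hj
          have : Set.Ici n ∪ (Finset.range n : Set ℕ) = Set.univ := by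
            ext x; simp
          rw [Function.update_self, this]
          simp [hT, slotBox, ha, has]
        · simp [hj]
      have e3 : S.restrict (T t) (u l) = S.restrict (T (insert a t)) (u l) +
          S.restrict (Function.update (T t) a (Finset.range n : Set ℕ)) (u l) := by
        conv_lhs => rw [e2]
        rw [e1]
        refine S.restrict_update_union _ _ ?_ _
        rw [Set.disjoint_left]
        intro x hx hx'
        simp at hx hx'
        omega
      have e4 : S.restrict (T (insert a t)) (u l) - S.restrict (slotBox s i Set.univ) (u l) =
          -S.restrict (Function.update (T t) a (Finset.range n : Set ℕ)) (u l) +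
          (S.restrict (T t) (u l) - S.restrict (slotBox s i Set.univ) (u l)) := by
        rw [e3]; abel
      rw [e4]
      refine (norm_add_le _ _).trans ?_
      rw [norm_neg]
  have hTs : T s = slotBox s i (Set.Ici n) := by
    funext j
    by_cases hj : j ∈ s <;> simp [hT, slotBox, hj]
  rw [← hTs]
  exact key s subset_rfl

end ArraySpace

end GlidingHump

/-! ### Construction of the humps and the growth contradiction -/

section GlidingHump

namespace ArraySpace

variable {m : ℕ} {W : Type*} [SeminormedAddCommGroup W] [NormedSpace ℂ W] {S : ArraySpace m W}
  {u : ℕ → W} {s : Finset (Fin m)} {i : Fin m → ℕ}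

/-- One step of the gliding hump: a later member of the sequence that is large far out, small on
the earlier blocks, and essentially finitely supported. -/
theorem exists_hump_step (hs : s.Nonempty)
    (hmin : ∀ t ⊂ s, ∀ i' : Fin m → ℕ,
      Tendsto (fun l => ‖S.restrict (slotBox t i' Set.univ) (u l)‖) atTop (𝓝 0))
    (hlim : ∀ w, Tendsto
      (fun n : ℕ => ‖w - S.restrict (fun j => if j ∈ s then Set.Iio n else Set.univ) w‖)
      atTop (𝓝 0))
    {η : ℝ} (hη : 0 < η)
    (hfreq : ∃ᶠ l in atTop, η ≤ ‖S.restrict (slotBox s i Set.univ) (u l)‖)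
    {κ : ℝ} (hκ : 0 < κ) (n l₀ : ℕ) :
    ∃ n' l, l₀ < l ∧ n < n' ∧ η / 2 ≤ ‖S.restrict (slotBox s i (Set.Ici n)) (u l)‖ ∧
      (∀ b ≤ n, ∀ a ≤ b, ‖S.restrict (slotBox s i (Set.Ico a b)) (u l)‖ ≤ κ) ∧
      ∀ n'' ≥ n',
        ‖u l - S.restrict (fun j => if j ∈ s then Set.Iio n'' else Set.univ) (u l)‖ ≤ κ := by
  -- A bounded range in a single slot of s already forces convergence to zero, so `hs` is needed to
  -- pick such a slot. All intervals below n are handled together because the recursion remembers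
  -- only the last cut and the last index, not the earlier blocks.
  have hblock : ∀ a b : ℕ,
      ∀ᶠ l in atTop, ‖S.restrict (slotBox s i (Set.Ico a b)) (u l)‖ ≤ κ := by
    intro a b
    obtain ⟨j₀, hj₀⟩ := hs
    have h := tendsto_restrict_update_finite (S := S) (i := i) hmin (D := slotBox s i (Set.Ico a b))
      (fun j hj => by simp [slotBox, hj]) hj₀ (Finset.Ico a b)
    have e : Function.update (slotBox s i (Set.Ico a b)) j₀ (Finset.Ico a b : Set ℕ) =
        slotBox s i (Set.Ico a b) := by
      rw [Function.update_eq_self_iff, Finset.coe_Ico]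
      simp [slotBox, hj₀]
    rw [e] at h
    exact (h.eventually_lt_const hκ).mono fun l hl => hl.le
  have hblocks : ∀ᶠ l in atTop, ∀ b ∈ Set.Iic n, ∀ a ∈ Set.Iic b,
      ‖S.restrict (slotBox s i (Set.Ico a b)) (u l)‖ ≤ κ :=
    (eventually_all_finite (Set.finite_Iic n)).2 fun b _ =>
      (eventually_all_finite (Set.finite_Iic b)).2 fun a _ => hblock a b
  have hcut := (tendsto_restrict_sub (S := S) (i := i) hmin n).eventually_lt_const (half_pos hη)
  obtain ⟨l, hl1, hl2, hl3, hl4⟩ :=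
    (hfreq.and_eventually (hblocks.and (hcut.and (eventually_gt_atTop l₀)))).exists
  obtain ⟨n', hn'⟩ := eventually_atTop.1 ((hlim (u l)).eventually_lt_const hκ)
  refine ⟨max n' (n + 1), l, hl4, by omega, ?_, fun b hb a ha => hl2 b hb a ha, fun n'' hn'' =>
    (hn' n'' (le_trans (le_max_left _ _) hn'')).le⟩
  have := norm_sub_norm_le (S.restrict (slotBox s i Set.univ) (u l))
    (S.restrict (slotBox s i (Set.Ici n)) (u l))
  rw [norm_sub_rev] at this
  linarith

/-- In an array space whose block restrictions satisfy a lower estimate of exponent `σ`,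
a seminormalized sequence cannot have signed sums that grow with an exponent `ρ < 1 - σ`. -/
theorem false_of_growth
    (hlim : ∀ (s : Finset (Fin m)) (w : W), Tendsto
      (fun n : ℕ => ‖w - S.restrict (fun j => if j ∈ s then Set.Iio n else Set.univ) w‖)
      atTop (𝓝 0))
    {A σ : ℝ} (hlow : ∀ (N : ℕ), 0 < N → ∀ s : Finset (Fin m), s.Nonempty →
      ∀ (D : Fin N → Fin m → Set ℕ) (i : Fin m → ℕ),
      (∀ j ∈ s, Pairwise fun k l => Disjoint (D k j) (D l j)) → (∀ j ∉ s, ∀ k, D k j = {i j}) →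
      ∀ w, ∑ k, ‖S.restrict (D k) w‖ ≤ A * (N : ℝ) ^ σ * ‖w‖) (hA : 0 ≤ A)
    {δ : ℝ} (hδ : 0 < δ) (hu : ∀ l, δ ≤ ‖u l‖) {B ρ : ℝ}
    (hup : ∀ (F : Finset ℕ) (c : ℕ → ℂ), (∀ l, ‖c l‖ = 1) →
      ‖∑ l ∈ F, c l • u l‖ ≤ B * (F.card : ℝ) ^ ρ) (hρ : ρ < 1) (hσρ : σ + ρ < 1) : False := by
  obtain ⟨s, i, hs, hnt, hmin⟩ := exists_minimal_slots (S := S) hδ hu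
    fun i => tendsto_restrict_singleton hρ hup i
  obtain ⟨η, hη, hfreq⟩ : ∃ η > 0,
      ∃ᶠ l in atTop, η ≤ ‖S.restrict (slotBox s i Set.univ) (u l)‖ := by
    rw [Metric.tendsto_nhds] at hnt
    push Not at hnt
    obtain ⟨η, hη, h⟩ := hnt
    refine ⟨η, hη, h.mono fun l hl => ?_⟩
    simpa using hl
  refine not_forall_mul_le_rpow (c := η / 4) (B := A * B) (by positivity) hσρ fun N hN => ?_
  have hNr : (0 : ℝ) < N := by exact_mod_cast hN
  have hb := S.bound_pos
  -- The errors in block k are one own tail and N - 1 cross terms, each at most `S.bound * κ`. Their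
  -- total η/4 leaves η/4 of the main part η/2. Since κ depends on N, the subsequence is built anew
  -- for each N.
  set κ : ℝ := η / (4 * (N * S.bound)) with hκ
  have hκ0 : 0 < κ := by positivity
  choose nx lx hlx hnx hbig hsmall htail using
    exists_hump_step (S := S) (i := i) hs hmin (hlim s) hη hfreq hκ0
  -- The pair g k holds a cut and an index. The vector v k uses the index of g (k+1), since it is
  -- chosen after the cut (g k).1: it is large beyond that cut, and its tail is small from the cut
  -- (g (k+1)).1 on.
  set g : ℕ → ℕ × ℕ := fun k => Nat.rec (0, 0) (fun _ q => (nx q.1 q.2, lx q.1 q.2)) k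
  have hn : StrictMono fun k => (g k).1 := strictMono_nat_of_lt_succ fun k => hnx _ _
  have hl : StrictMono fun k => (g (k + 1)).2 := strictMono_nat_of_lt_succ fun k => hlx _ _
  set v : ℕ → W := fun k => u (g (k + 1)).2 with hv
  set D : ℕ → Fin m → Set ℕ := fun k => slotBox s i (Set.Ico (g k).1 (g (k + 1)).1) with hD
  have hown : ∀ k, η / 2 - S.bound * κ ≤ ‖S.restrict (D k) (v k)‖ := by
    intro k
    set Q : W := S.restrict (fun j => if j ∈ s then Set.Iio (g (k + 1)).1 else Set.univ) (v k)
    have h1 : S.restrict (slotBox s i (Set.Ici (g k).1)) Q = S.restrict (D k) (v k) := by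
      rw [S.restrict_restrict]
      congr 1
      congr 1
      funext j
      by_cases hj : j ∈ s
      · simp [hD, slotBox, hj, Set.Ici_inter_Iio]
      · simp [hD, slotBox, hj]
    have h2 : ‖S.restrict (slotBox s i (Set.Ici (g k).1)) (v k - Q)‖ ≤ S.bound * κ :=
      (S.norm_restrict_le _ _).trans (mul_le_mul_of_nonneg_left (htail _ _ _ le_rfl) hb.le)
    rw [map_sub, h1] at h2
    have h3 := norm_sub_norm_le (S.restrict (slotBox s i (Set.Ici (g k).1)) (v k))
      (S.restrict (D k) (v k))
    have h4 : η / 2 ≤ ‖S.restrict (slotBox s i (Set.Ici (g k).1)) (v k)‖ := hbig _ _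
    linarith
  have hcross : ∀ k l, l ≠ k → ‖S.restrict (D k) (v l)‖ ≤ S.bound * κ := by
    intro k l hlk
    -- For l < k the block D k lies beyond the essential support of v l. For l > k the vector v l
    -- was chosen small on every interval below its starting cut, hence on D k.
    rcases lt_or_gt_of_ne hlk with h | h
    · set Q : W := S.restrict (fun j => if j ∈ s then Set.Iio (g k).1 else Set.univ) (v l)
      have h1 : S.restrict (D k) Q = 0 := by
        obtain ⟨j₀, hj₀⟩ := hs
        rw [S.restrict_restrict]
        refine S.restrict_eq_zero (a := j₀) ?_ _
        ext x
        simp [hD, slotBox, hj₀]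
      have h2 : S.restrict (D k) (v l) = S.restrict (D k) (v l - Q) := by
        rw [map_sub, h1, sub_zero]
      rw [h2]
      refine (S.norm_restrict_le _ _).trans (mul_le_mul_of_nonneg_left ?_ hb.le)
      exact htail _ _ _ (hn.monotone (Nat.succ_le_of_lt h))
    · refine le_trans ?_ (le_mul_of_one_le_left hκ0.le S.one_le_bound)
      exact hsmall _ _ _ (hn.monotone (Nat.succ_le_of_lt h)) _ (hn.monotone (Nat.le_succ k))
  set x : W := ∑ k : Fin N, v k with hx
  have hblock : ∀ k : Fin N, η / 4 ≤ ‖S.restrict (D k) x‖ := by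
    intro k
    have h1 : S.restrict (D k) x = S.restrict (D k) (v k) +
        ∑ l ∈ Finset.univ.erase k, S.restrict (D k) (v l) := by
      rw [hx, map_sum, Finset.add_sum_erase _ (fun l : Fin N => S.restrict (D k) (v l))
        (Finset.mem_univ k)]
    have h2 : ‖∑ l ∈ Finset.univ.erase k, S.restrict (D k) (v l)‖ ≤ (N - 1) * (S.bound * κ) := by
      refine (norm_sum_le_of_le (Finset.univ.erase k) fun (l : Fin N) hl =>
        hcross k l ?_).trans (le_of_eq ?_)
      · exact fun h => Finset.ne_of_mem_erase hl (Fin.ext h)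
      · rw [Finset.sum_const, Finset.card_erase_of_mem (Finset.mem_univ k), Finset.card_univ,
          Fintype.card_fin, nsmul_eq_mul, Nat.cast_pred hN]
    have h3 : N * (S.bound * κ) = η / 4 := by
      rw [hκ]
      field_simp
    have h4 := hown k
    have h5 := norm_sub_le_norm_add (S.restrict (D k) (v k))
      (∑ l ∈ Finset.univ.erase k, S.restrict (D k) (v l))
    rw [h1]
    linarith
  have hxn : ‖x‖ ≤ B * (N : ℝ) ^ ρ := by
    have h1 := hup (Finset.univ.map ⟨fun k : Fin N => (g (k + 1)).2,
      fun a b h => Fin.ext (hl.injective h)⟩) (fun _ => 1) (fun _ => norm_one)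
    rw [Finset.card_map, Finset.card_univ, Fintype.card_fin, Finset.sum_map] at h1
    simp only [one_smul] at h1
    exact h1
  have hdisj : ∀ j ∈ s, Pairwise fun k l : Fin N => Disjoint (D k j) (D l j) := by
    intro j hj
    refine (pairwise_disjoint_on fun k : Fin N => D k j).2 fun k l hkl => ?_
    rw [Set.disjoint_left]
    intro y hy hy'
    simp only [hD, slotBox, hj, if_true, Set.mem_Ico] at hy hy'
    have : (g (k + 1)).1 ≤ (g l).1 := hn.monotone (Nat.succ_le_of_lt hkl)
    omega
  have hfin := hlow N hN s hs (fun k => D k) i hdisj (fun j hj k => by simp [hD, slotBox, hj]) x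
  calc η / 4 * N = ∑ _k : Fin N, η / 4 := by
        rw [Finset.sum_const, Finset.card_univ, Fintype.card_fin, nsmul_eq_mul, mul_comm]
    _ ≤ ∑ k : Fin N, ‖S.restrict (D k) x‖ := Finset.sum_le_sum fun k _ => hblock k
    _ ≤ A * (N : ℝ) ^ σ * ‖x‖ := hfin
    _ ≤ A * (N : ℝ) ^ σ * (B * (N : ℝ) ^ ρ) := mul_le_mul_of_nonneg_left hxn (by positivity)
    _ = A * B * (N : ℝ) ^ (σ + ρ) := by rw [Real.rpow_add hNr]; ring

end ArraySpace

end GlidingHump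

/-- The complementary operator `1 - A`. -/
def InterpolationCouple.CoupleEnd.oneSub {X₀ X₁ V : Type*}
    [NormedAddCommGroup X₀] [NormedSpace ℂ X₀] [CompleteSpace X₀]
    [NormedAddCommGroup X₁] [NormedSpace ℂ X₁] [CompleteSpace X₁]
    [AddCommGroup V] [Module ℂ V] [TopologicalSpace V] [IsTopologicalAddGroup V]
    [ContinuousSMul ℂ V] [T2Space V] {C : InterpolationCouple X₀ X₁ V} (A : C.CoupleEnd) :
    C.CoupleEnd where
  map₀ := ContinuousLinearMap.id ℂ X₀ - A.map₀
  map₁ := ContinuousLinearMap.id ℂ X₁ - A.map₁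
  ambient := LinearMap.id - A.ambient
  comm₀ x := by
    change C.emb₀ (x - A.map₀ x) = C.emb₀ x - A.ambient (C.emb₀ x)
    rw [map_sub, A.comm₀]
  comm₁ x := by
    change C.emb₁ (x - A.map₁ x) = C.emb₁ x - A.ambient (C.emb₁ x)
    rw [map_sub, A.comm₁]

/-! ### The interpolated tensor products as an array space -/

section TensorCouple

variable {m : ℕ} (p₀ p₁ : ℝ≥0∞) [Fact (1 ≤ p₀)] [Fact (1 ≤ p₁)]

/-- The restriction to a box as an endomorphism of the couple of tensor products. -/
def tensorCoupleRestrict (D : Fin m → Set ℕ) : (tensorCouple m p₀ p₁).CoupleEnd where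
  map₀ := tensorRestrict p₀ m D
  map₁ := tensorRestrict p₁ m D
  ambient := arrayRestrict D
  comm₀ := tensorCoeff_tensorRestrict D
  comm₁ := tensorCoeff_tensorRestrict D

/-- The interpolation space of tensor products as a space of arrays. -/
def interpolateArraySpace {θ : ℝ} (hθ : θ ∈ Set.Ioo (0 : ℝ) 1) :
    ArraySpace m ((tensorCouple m p₀ p₁).Interpolate θ) where
  coeff := (tensorCouple m p₀ p₁).toAmbient θ
  injective := toAmbient_injective θ
  restrict D := (tensorCoupleRestrict p₀ p₁ D).onInterp θ
  coeff_restrict D w := (tensorCoupleRestrict p₀ p₁ D).toAmbient_onInterp θ w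
  bound := max 1 (interpConst θ * (2 * gaussMass))
  one_le_bound := le_max_left _ _
  norm_restrict_le D w := by
    have h := sum_norm_onInterp_le hθ (fun _ : Unit => tensorCoupleRestrict p₀ p₁ D)
      one_pos one_pos (fun x => by
        rw [Fintype.sum_unique, one_mul]; exact norm_tensorRestrict_le (q := p₀) D x)
      (fun x => by
        rw [Fintype.sum_unique, one_mul]; exact norm_tensorRestrict_le (q := p₁) D x) w
    rw [Fintype.sum_unique, Real.one_rpow, Real.one_rpow, mul_one, mul_one] at h
    exact h.trans (mul_le_mul_of_nonneg_right (le_max_right _ _) (norm_nonneg _))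

variable {p₀ p₁}

/-- Apply `tendsto_onInterp` to the complements of the restrictions, of norm at most 2 at both
endpoints. Strong convergence is needed only at p₀, where it follows from p₀ < ∞. -/
theorem tendsto_sub_restrict_interpolate (hp₀ : p₀ ≠ ⊤) {θ : ℝ} (hθ : θ ∈ Set.Ioo (0 : ℝ) 1)
    (s : Finset (Fin m)) (w : (tensorCouple m p₀ p₁).Interpolate θ) :
    Tendsto (fun n : ℕ => ‖w - (interpolateArraySpace p₀ p₁ hθ).restrict
      (fun j => if j ∈ s then Set.Iio n else Set.univ) w‖) atTop (𝓝 0) := by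
  have h := tendsto_onInterp hθ (fun n : ℕ => (tensorCoupleRestrict p₀ p₁
    fun j => if j ∈ s then Set.Iio n else Set.univ).oneSub) (K := 2)
    (fun n x => ?_) (fun n x => ?_) (fun x => ?_) w
  · refine h.congr fun n => congrArg norm (toAmbient_injective θ ?_)
    rw [CoupleEnd.toAmbient_onInterp, map_sub]
    change _ - _ = _ - (tensorCouple m p₀ p₁).toAmbient θ (CoupleEnd.onInterp _ θ w)
    rw [CoupleEnd.toAmbient_onInterp]
    rfl
  · refine (norm_sub_le _ _).trans ?_
    change ‖x‖ + ‖tensorRestrict p₀ m _ x‖ ≤ _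
    linarith [norm_tensorRestrict_le (fun j => if j ∈ s then Set.Iio n else Set.univ) x]
  · refine (norm_sub_le _ _).trans ?_
    change ‖x‖ + ‖tensorRestrict p₁ m _ x‖ ≤ _
    linarith [norm_tensorRestrict_le (fun j => if j ∈ s then Set.Iio n else Set.univ) x]
  · have h := (tendsto_tensorRestrict hp₀ (s : Set (Fin m)) x).const_sub x
    rw [sub_self] at h
    exact h

/-- Interpolates N^(m(1 - 1/p₀)) from `sum_norm_tensorRestrict_le` with the trivial bound N at p₁,
where each of the N restrictions is a contraction. -/
theorem sum_norm_restrict_interpolate_le (hp₀ : p₀ ≠ ⊤) {θ : ℝ} (hθ : θ ∈ Set.Ioo (0 : ℝ) 1)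
    {N : ℕ} (hN : 0 < N) {s : Finset (Fin m)} (hs : s.Nonempty) (D : Fin N → Fin m → Set ℕ)
    (i : Fin m → ℕ) (hD : ∀ j ∈ s, Pairwise fun k l => Disjoint (D k j) (D l j))
    (hi : ∀ j ∉ s, ∀ k, D k j = {i j}) (w : (tensorCouple m p₀ p₁).Interpolate θ) :
    ∑ k, ‖(interpolateArraySpace p₀ p₁ hθ).restrict (D k) w‖ ≤
      interpConst θ * (2 * gaussMass) *
        (N : ℝ) ^ ((1 - θ) * (m * (1 - p₀.toReal⁻¹)) + θ) * ‖w‖ := by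
  have hNr : (0 : ℝ) < N := by exact_mod_cast hN
  have : Nonempty (Fin N) := ⟨⟨0, hN⟩⟩
  have h := sum_norm_onInterp_le hθ (fun k : Fin N => tensorCoupleRestrict p₀ p₁ (D k))
    (a₀ := (N : ℝ) ^ (m * (1 - p₀.toReal⁻¹))) (a₁ := N) (by positivity) hNr
    (fun x => by
      have := sum_norm_tensorRestrict_le hp₀ hs hD hi x
      rwa [Fintype.card_fin] at this)
    (fun x => by
      refine (Finset.sum_le_sum fun k _ => norm_tensorRestrict_le (q := p₁) (D k) x).trans ?_
      simp) w
  refine h.trans (le_of_eq ?_)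
  rw [← Real.rpow_mul hNr.le, ← Real.rpow_add hNr]
  congr 4
  ring

end TensorCouple

/-! ### Comparison of the exponents -/

theorem theorem2p3 (m : ℕ) (hm : 3 ≤ m) (p₀ p₁ : ℝ≥0∞) [Fact (1 ≤ p₀)] [Fact (1 ≤ p₁)]
    (h₀ : p₀ < ENNReal.conjExponent (m : ℝ≥0∞)) (h₁ : ENNReal.conjExponent (m : ℝ≥0∞) < p₁)
    (θ : ℝ) (hθ : θ ∈ Set.Ioo (0 : ℝ) 1) (p : ℝ≥0∞) [Fact (1 ≤ p)]
    (hp : p⁻¹ = ENNReal.ofReal (1 - θ) / p₀ + ENNReal.ofReal θ / p₁) :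
    IsEmpty ((tensorCouple m p₀ p₁).Interpolate θ ≃L[ℂ] TensorSeq m p) := by
  have hmr : (3 : ℝ) ≤ m := by exact_mod_cast hm
  have hm1 : (1 : ℝ≥0∞) ≤ m := by exact_mod_cast (show 1 ≤ m by omega)
  have hθ1 : 0 < 1 - θ := by linarith [hθ.2]
  have hp₀1 : (1 : ℝ≥0∞) ≤ p₀ := Fact.out
  have hp₁1 : (1 : ℝ≥0∞) ≤ p₁ := Fact.out
  have hp₀ : p₀ ≠ ⊤ := h₀.ne_top
  have hc : (ENNReal.conjExponent (m : ℝ≥0∞))⁻¹.toReal = 1 - (m : ℝ)⁻¹ := by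
    have hconj := ENNReal.HolderConjugate.conjExponent hm1
    have h := ENNReal.HolderConjugate.inv_add_inv_eq_one (m : ℝ≥0∞)
      (ENNReal.conjExponent (m : ℝ≥0∞))
    have hf : (ENNReal.conjExponent (m : ℝ≥0∞))⁻¹ ≠ ⊤ :=
      ne_top_of_le_ne_top ENNReal.one_ne_top (h ▸ le_add_self)
    have hf' : ((m : ℝ≥0∞))⁻¹ ≠ ⊤ :=
      ne_top_of_le_ne_top ENNReal.one_ne_top (h ▸ le_self_add)
    have h2 := congrArg ENNReal.toReal h
    rw [ENNReal.toReal_add hf' hf, ENNReal.toReal_inv, ENNReal.toReal_natCast,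
      ENNReal.toReal_one] at h2
    linarith
  set x₀ := p₀.toReal⁻¹ with hx₀
  set x₁ := p₁.toReal⁻¹ with hx₁
  have hi₀ : p₀⁻¹ ≠ ⊤ := ENNReal.inv_ne_top.2 (zero_lt_one.trans_le hp₀1).ne'
  have hi₁ : p₁⁻¹ ≠ ⊤ := ENNReal.inv_ne_top.2 (zero_lt_one.trans_le hp₁1).ne'
  have hx₀c : 1 - (m : ℝ)⁻¹ < x₀ := by
    rw [← hc, hx₀, ← ENNReal.toReal_inv]
    exact ENNReal.toReal_strict_mono hi₀ (ENNReal.inv_lt_inv.2 h₀)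
  have hx₁c : x₁ < 1 - (m : ℝ)⁻¹ := by
    rw [← hc, hx₁, ← ENNReal.toReal_inv]
    refine ENNReal.toReal_strict_mono ?_ (ENNReal.inv_lt_inv.2 h₁)
    exact ENNReal.inv_ne_top.2 (pos_of_gt h₀).ne'
  have hx₀1 : x₀ ≤ 1 := by
    rw [hx₀, ← ENNReal.toReal_inv]
    simpa using ENNReal.toReal_mono ENNReal.one_ne_top (ENNReal.inv_le_one.2 hp₀1)
  have hx : p.toReal⁻¹ = (1 - θ) * x₀ + θ * x₁ := by
    have h := congrArg ENNReal.toReal hp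
    rw [div_eq_mul_inv, div_eq_mul_inv, ENNReal.toReal_add
      (ENNReal.mul_ne_top ENNReal.ofReal_ne_top hi₀)
      (ENNReal.mul_ne_top ENNReal.ofReal_ne_top hi₁), ENNReal.toReal_mul, ENNReal.toReal_mul,
      ENNReal.toReal_ofReal hθ1.le, ENNReal.toReal_ofReal hθ.1.le, ENNReal.toReal_inv,
      ENNReal.toReal_inv, ENNReal.toReal_inv] at h
    exact h
  have hm0 : (0 : ℝ) < m := by linarith
  have hmi : (m : ℝ) * (m : ℝ)⁻¹ = 1 := mul_inv_cancel₀ hm0.ne'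
  have hmi0 : 0 < (m : ℝ)⁻¹ := inv_pos.2 hm0
  have hmi1 : (m : ℝ)⁻¹ < 1 := inv_lt_one_of_one_lt₀ (by linarith)
  have hx₁0 : 0 ≤ x₁ := inv_nonneg.2 ENNReal.toReal_nonneg
  -- Here x₁ = 0 when p₁ = ∞, as `toReal` of ⊤ is 0 and so is its inverse. Positivity of x₀ then
  -- keeps p finite, and x₁ < 1 gives p > 1, so p has a real conjugate exponent.
  have hxpos : 0 < p.toReal⁻¹ := by
    rw [hx]
    exact add_pos_of_pos_of_nonneg (mul_pos hθ1 (by linarith)) (mul_nonneg hθ.1.le hx₁0)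
  have hxlt : p.toReal⁻¹ < 1 := by
    have e₀ : (1 - θ) * x₀ ≤ 1 - θ := mul_le_of_le_one_right hθ1.le hx₀1
    have e₁ : θ * x₁ < θ := mul_lt_of_lt_one_right hθ.1 (by linarith)
    linarith
  have hp1 : 1 < p.toReal := by
    rw [← inv_inv p.toReal]
    exact (one_lt_inv₀ hxpos).2 hxlt
  have hr := Real.HolderConjugate.conjExponent hp1
  set r := Real.conjExponent p.toReal
  have hrinv : r⁻¹ = 1 - p.toReal⁻¹ := by linarith [hr.inv_add_inv_eq_one]
  have hy₀ : m * (1 - x₀) < 1 := by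
    rw [← hmi]; exact mul_lt_mul_of_pos_left (by linarith) hm0
  have hy₁ : 1 < m * (1 - x₁) := by
    rw [← hmi]; exact mul_lt_mul_of_pos_left (by linarith) hm0
  refine ⟨fun T => ?_⟩
  set S := interpolateArraySpace (m := m) p₀ p₁ hθ
  set u : ℕ → (tensorCouple m p₀ p₁).Interpolate θ := fun l => T.symm (diagVector m p l) with hu
  set T₁ := (T : (tensorCouple m p₀ p₁).Interpolate θ →L[ℂ] TensorSeq m p)
  set T₂ := (T.symm : TensorSeq m p →L[ℂ] (tensorCouple m p₀ p₁).Interpolate θ)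
  -- The summand 1 only keeps the inverse positive without a separate argument that T₁ is nonzero.
  have hlow : ∀ l, (‖T₁‖ + 1)⁻¹ ≤ ‖u l‖ := fun l => by
    rw [inv_le_iff_one_le_mul₀' (by positivity)]
    have h1 : T₁ (u l) = diagVector m p l := T.apply_symm_apply _
    have h2 := T₁.le_opNorm (u l)
    rw [h1] at h2
    have h3 := one_le_norm_diagVector (p := p) m l
    have h4 := norm_nonneg (u l)
    nlinarith
  refine ArraySpace.false_of_growth (S := S) (u := u) (B := ‖T₂‖) (ρ := max 0 (1 - m * r⁻¹))
    (fun s w => tendsto_sub_restrict_interpolate hp₀ hθ s w)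
    (fun N hN s hs D i hD hi w => sum_norm_restrict_interpolate_le hp₀ hθ hN hs D i hD hi w)
    (mul_nonneg (interpConst_nonneg hθ) (mul_nonneg zero_le_two gaussMass_nonneg))
    (δ := (‖T₁‖ + 1)⁻¹) (by positivity) hlow (fun F c hc => ?_) ?_ ?_
  · have h1 : ∑ l ∈ F, c l • u l = T₂ (∑ l ∈ F, c l • diagVector m p l) := by
      rw [map_sum]
      exact Finset.sum_congr rfl fun l _ => (map_smul T₂ _ _).symm
    rw [h1]
    exact (T₂.le_opNorm _).trans (mul_le_mul_of_nonneg_left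
      (norm_sum_diagVector_le (by omega) hr F c hc) (norm_nonneg _))
  · rw [max_lt_iff, hrinv]
    have := mul_pos hm0 (show 0 < 1 - p.toReal⁻¹ by linarith)
    exact ⟨one_pos, by linarith⟩
  · rw [← max_add_add_left, max_lt_iff, hrinv, hx]
    have e₀ := mul_lt_mul_of_pos_left hy₀ hθ1
    have e₁ := mul_lt_mul_of_pos_left hy₁ hθ.1
    constructor <;> nlinarith

end
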